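/- Let $\mathscr{F}f(\xi)=\int_{\mathbb{R}^3}e^{-ix\cdot\xi}f(x)\,dx$ denote the Fourier transform on $\mathbb{R}^3$, extended to tempered distributions, and let $\phi_0\in\mathscr{S}(\mathbb{R}^3)$ be real-valued with $0\le\phi_0\le1$, $\operatorname{supp}\phi_0\subset\{\xi\in\mathbb{R}^3: 2^{-1}\le|\xi|\le2\}$ and $\sum_{j\in\mathbb{Z}}\phi_j(\xi)=1$ for all $\xi\in\mathbb{R}^3\setminus\{0\}$, where $\phi_j(\xi):=\phi_0(2^{-j}\xi)$. Put $\Delta_jf:=\mathscr{F}^{-1}[\phi_j\mathscr{F}f]$ for $j\in\mathbb{Z}$ and $f\in\mathscr{S}'(\mathbb{R}^3)$. Let $$\lambda^{\pm}(\xi):=\frac12\left(\sqrt{|\xi|^2+2\xi_3+1}\pm\sqrt{|\xi|^2-2\xi_3+1}\right),\qquad \xi\in\mathbb{R}^3,$$ and, for $t\in\mathbb{R}$ and $\psi\in L^1(\mathbb{R}^3)$, put $e^{it\lambda^{\pm}(D)}\psi:=\mathscr{F}^{-1}[e^{it\lambda^{\pm}(\xi)}\mathscr{F}\psi(\xi)]\in\mathscr{S}'(\mathbb{R}^3)$.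 Then there exists a constant $C>0$, depending only on $\phi_0$, such that, for both signs and for all $t\in\mathbb{R}$, $j\in\mathbb{Z}$ and $\psi\in L^1(\mathbb{R}^3)$, the distribution $\Delta_je^{it\lambda^{\pm}(D)}\psi$ belongs to $L^\infty(\mathbb{R}^3)$ and $$\left\|\Delta_je^{it\lambda^{\pm}(D)}\psi\right\|_{L^\infty}\le C\,2^{3j}\left(1+\min\{2^{3j},1\}|t|\right)^{-1}\|\psi\|_{L^1}.$$ -/

import Mathlib

open MeasureTheory FourierTransform
open scoped SchwartzMap ENNReal

noncomputable section

/-- Three-dimensional Euclidean space; the coordinates `ξ₁, ξ₂, ξ₃` are `ξ 0, ξ 1, ξ 2`. -/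
abbrev R3 : Type := EuclideanSpace ℝ (Fin 3)

/-- `η^±(ξ) = √(|ξ|² ± 2 ξ₃ + 1)`, where the sign is `s = 1` or `s = -1`. -/
def eta (s : ℤˣ) (ξ : R3) : ℝ := Real.sqrt (‖ξ‖ ^ 2 + ((s : ℤ) : ℝ) * (2 * ξ 2) + 1)

/-- The eigenfrequencies `λ^±(ξ) = (η^+(ξ) ± η^-(ξ)) / 2`, with sign `s = 1` or `s = -1`. -/
def lam (s : ℤˣ) (ξ : R3) : ℝ := (1 / 2) * (eta 1 ξ + ((s : ℤ) : ℝ) * eta (-1) ξ)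

/-- `φ₀` generates a homogeneous Littlewood-Paley partition of unity. -/
structure IsLittlewoodPaley (φ₀ : 𝓢(R3, ℝ)) : Prop where
  nonneg : ∀ ξ, 0 ≤ φ₀ ξ
  le_one : ∀ ξ, φ₀ ξ ≤ 1
  support_subset : tsupport φ₀ ⊆ {ξ : R3 | 2⁻¹ ≤ ‖ξ‖ ∧ ‖ξ‖ ≤ 2}
  hasSum : ∀ ξ : R3, ξ ≠ 0 → HasSum (fun j : ℤ ↦ φ₀ ((2 : ℝ) ^ (-j) • ξ)) 1

/-- The dyadic block `Δ_j`, i.e. the Fourier multiplier `φ_j(D)` on tempered distributions with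
`φ_j(ξ) = φ₀(2^{-j} ξ)`. As `𝓕` has the kernel `exp(-2πi x·ξ)`, the operator `m(D)`, `D = -i∇`,
acts on the `𝓕` side as multiplication by `m(2πξ)`. -/
def dyadicBlock (φ₀ : 𝓢(R3, ℝ)) (j : ℤ) : 𝓢'(R3, ℂ) →L[ℂ] 𝓢'(R3, ℂ) :=
  TemperedDistribution.fourierMultiplierCLM ℂ
    (fun ξ : R3 ↦ ((φ₀ ((2 : ℝ) ^ (-j) • ((2 * Real.pi) • ξ)) : ℝ) : ℂ))

/-- The function `e^{itλ^±} ψ̂`, in the frequency variable of `𝓕` (so that `λ^±` is taken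
at `2πξ`). -/
def evolutionSymbol (s : ℤˣ) (t : ℝ) (ψ : Lp ℂ 1 (volume : Measure R3)) (ξ : R3) : ℂ :=
  Complex.exp (Complex.I * t * lam s ((2 * Real.pi) • ξ)) * 𝓕 (ψ : R3 → ℂ) ξ

theorem evolutionSymbol_memLp (s : ℤˣ) (t : ℝ) (ψ : Lp ℂ 1 (volume : Measure R3)) :
    MemLp (evolutionSymbol s t ψ) ∞ volume := by
  have hψ : Integrable (ψ : R3 → ℂ) volume := L1.integrable_coeFn ψ
  have hc : Continuous (𝓕 (ψ : R3 → ℂ)) :=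
    VectorFourier.fourierIntegral_continuous Real.continuous_fourierChar
      (by exact continuous_inner) hψ
  have hl : Continuous (fun ξ : R3 ↦ lam s ((2 * Real.pi) • ξ)) := by
    unfold lam eta
    fun_prop
  have hcont : Continuous (evolutionSymbol s t ψ) := by
    unfold evolutionSymbol
    fun_prop
  refine memLp_top_of_bound hcont.aestronglyMeasurable (∫ x, ‖(ψ : R3 → ℂ) x‖)
    (Filter.Eventually.of_forall fun ξ ↦ ?_)
  have h1 : ‖Complex.exp (Complex.I * t * lam s ((2 * Real.pi) • ξ))‖ = 1 := by
    rw [show Complex.I * t * lam s ((2 * Real.pi) • ξ)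
      = ((t * lam s ((2 * Real.pi) • ξ) : ℝ) : ℂ) * Complex.I by push_cast; ring]
    exact Complex.norm_exp_ofReal_mul_I _
  rw [evolutionSymbol, norm_mul, h1, one_mul]
  exact VectorFourier.norm_fourierIntegral_le_integral_norm _ _ _ _ _

/-- The evolution group `e^{itλ^±(D)}` on `L¹`: for `ψ ∈ L¹` the function `e^{itλ^±} ψ̂` is
bounded, hence a tempered distribution, and `e^{itλ^±(D)} ψ` is its inverse Fourier transform. -/
def evolution (s : ℤˣ) (t : ℝ) (ψ : Lp ℂ 1 (volume : Measure R3)) : 𝓢'(R3, ℂ) :=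
  𝓕⁻ (Lp.toTemperedDistribution ((evolutionSymbol_memLp s t ψ).toLp (evolutionSymbol s t ψ)))

end

/-! ### One-dimensional oscillatory integrals -/

/-! The functions η^± are the distances from ξ to the points (0, 0, ∓1). In prolate spheroidal
coordinates (σ, θ, φ) with these foci, η^± = σ ± cos θ, so the eigenfrequencies become coordinate
functions: λ^+ = σ and λ^- = cos θ. The volume element is (σ² - cos² θ) sin θ dσ dθ dφ, and |ξ|² =
σ² + cos² θ - 1.

By Young's inequality it suffices to bound the kernel ∫ e^{i(x·ξ + tλ(ξ))} f(ξ/R) dξ, R = 2^j,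
uniformly in x. The size R³ is trivial; the point is the bound max(R, 1)³/|t|
(`exists_norm_dispersiveKernel_mul_le`). Two devices remove everything but the oscillation. First,
σ² - cos² θ = 2σ² - 1 - |ξ|², and |ξ|² is absorbed into the cutoff, so only the weights σ² and 1
remain (`dispersiveKernel_eq_spheroidal`). Second, by Fourier inversion the cutoff is a
superposition of plane waves, which merely translate x (`norm_integral_mul_schwartz_le`). What is
left is an integral over 1 < σ ≤ L without cutoff, with L comparable to max(R, 1).

For fixed σ the angular integral is the Fourier transform of the measure on the unit sphere, 4π sinc
|·|, at an explicit point (`integral_sphere_wave`). With a = |x|, b² = x₁² + x₂² and c = x₃ this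
leaves ∫ sinc √(a²s² - b²) e^{its} ds for λ^+ and ∫ sinc √(b²(s² - 1) + (sc + t)²) ds for λ^-. Both
are O(L/|t|) uniformly in x, by `norm_integral_sinc_smul_exp_le` and
`abs_integral_sinc_sqrt_affine_le`; this is where all the decay comes from. -/

theorem norm_integral_smul_le_of_antideriv {E : Type*} [NormedAddCommGroup E] [NormedSpace ℝ E]
    [CompleteSpace E] {p q M : ℝ} {h h' G G' : ℝ → ℝ} {F f : ℝ → E} (hpq : p ≤ q)
    (hF : ∀ x ∈ Set.Icc p q, HasDerivAt F (f x) x) (hf : ContinuousOn f (Set.Icc p q))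
    (hM : ∀ x ∈ Set.Icc p q, ‖F x‖ ≤ M)
    (hh : ∀ x ∈ Set.Icc p q, HasDerivAt h (h' x) x) (hh' : ContinuousOn h' (Set.Icc p q))
    (hG : ∀ x ∈ Set.Icc p q, HasDerivAt G (G' x) x) (hG' : ContinuousOn G' (Set.Icc p q))
    (hle : ∀ x ∈ Set.Icc p q, |h' x| ≤ G' x) :
    ‖∫ x in p..q, h x • f x‖ ≤ M * (|h p| + |h q| + (G q - G p)) := by
  rw [← Set.uIcc_of_le hpq] at hF hf hh hh' hG hG'
  rw [intervalIntegral.integral_smul_deriv_eq_deriv_smul hh hF hh'.intervalIntegrable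
    hf.intervalIntegrable]
  have hp : p ∈ Set.Icc p q := ⟨le_rfl, hpq⟩
  have hq : q ∈ Set.Icc p q := ⟨hpq, le_rfl⟩
  have h1 : ‖∫ x in p..q, h' x • F x‖ ≤ ∫ x in p..q, M * G' x := by
    refine intervalIntegral.norm_integral_le_of_norm_le hpq ?_
      (hG'.intervalIntegrable.const_mul M)
    refine Filter.Eventually.of_forall fun x hx ↦ ?_
    have hx' := Set.Ioc_subset_Icc_self hx
    rw [norm_smul, mul_comm, Real.norm_eq_abs]
    exact mul_le_mul (hM x hx') (hle x hx') (abs_nonneg _) ((norm_nonneg _).trans (hM x hx'))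
  rw [intervalIntegral.integral_const_mul,
    intervalIntegral.integral_eq_sub_of_hasDerivAt hG hG'.intervalIntegrable] at h1
  have h2 : ‖h q • F q‖ ≤ M * |h q| := by
    rw [norm_smul, mul_comm, Real.norm_eq_abs]
    exact mul_le_mul_of_nonneg_right (hM q hq) (abs_nonneg _)
  have h3 : ‖h p • F p‖ ≤ M * |h p| := by
    rw [norm_smul, mul_comm, Real.norm_eq_abs]
    exact mul_le_mul_of_nonneg_right (hM p hp) (abs_nonneg _)
  have h4 := norm_sub_le (h q • F q - h p • F p) (∫ x in p..q, h' x • F x)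
  have h5 := norm_sub_le (h q • F q) (h p • F p)
  linarith

/-! ### Integrals of sinc of the square root of a quadratic (sign -) -/

theorem continuous_sinc_sqrt {Q : ℝ → ℝ} (hQ : Continuous Q) :
    Continuous fun s ↦ Real.sinc (Real.sqrt (Q s)) :=
  Real.continuous_sinc.comp (Real.continuous_sqrt.comp hQ)

theorem abs_sinc_le_inv {x : ℝ} (hx : 0 < x) : |Real.sinc x| ≤ x⁻¹ := by
  rw [Real.sinc_of_ne_zero hx.ne', abs_div, abs_of_pos hx, div_eq_mul_inv]
  exact mul_le_of_le_one_left (inv_nonneg.2 hx.le) (Real.abs_sin_le_one x)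

theorem abs_integral_sinc_sqrt_le_sub (Q : ℝ → ℝ) {u v : ℝ} (huv : u ≤ v) :
    |∫ x in u..v, Real.sinc (Real.sqrt (Q x))| ≤ v - u := by
  have := intervalIntegral.norm_integral_le_of_norm_le_const (a := u) (b := v)
    (f := fun x ↦ Real.sinc (Real.sqrt (Q x))) (C := 1) fun x _ ↦ Real.abs_sinc_le_one _
  rwa [one_mul, abs_of_nonneg (sub_nonneg.2 huv)] at this

/-- With w = √(x² + μ) one has w' = x/w, hence sinc w = x⁻¹ (-cos w)'. Integration by parts against
the decreasing weight x⁻¹ gives a bound free of μ. -/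
theorem abs_integral_sinc_sqrt_sq_add_le_of_pos {μ u v : ℝ} (hu : 1 ≤ u) (huv : u ≤ v)
    (hμ : 0 < u ^ 2 + μ) : |∫ x in u..v, Real.sinc (Real.sqrt (x ^ 2 + μ))| ≤ 2 := by
  have hpos : ∀ x ∈ Set.Icc u v, 0 < x ^ 2 + μ := fun x hx ↦ by nlinarith [hx.1]
  have hx0 : ∀ x ∈ Set.Icc u v, 0 < x := fun x hx ↦ by linarith [hx.1]
  have hw : ∀ x ∈ Set.Icc u v,
      HasDerivAt (fun x ↦ Real.sqrt (x ^ 2 + μ)) (x / Real.sqrt (x ^ 2 + μ)) x := fun x hx ↦ by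
    have := ((hasDerivAt_pow 2 x).add_const μ).sqrt (hpos x hx).ne'
    convert this using 1
    have := (Real.sqrt_pos.2 (hpos x hx)).ne'
    field_simp
    norm_num [mul_comm]
  have hsq : ContinuousOn (fun x ↦ Real.sqrt (x ^ 2 + μ)) (Set.Icc u v) :=
    (by fun_prop : Continuous fun x : ℝ ↦ Real.sqrt (x ^ 2 + μ)).continuousOn
  have hne : ∀ x ∈ Set.Icc u v, Real.sqrt (x ^ 2 + μ) ≠ 0 :=
    fun x hx ↦ (Real.sqrt_pos.2 (hpos x hx)).ne'
  have key := norm_integral_smul_le_of_antideriv (p := u) (q := v) (M := 1)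
    (h := fun x ↦ x⁻¹) (h' := fun x ↦ -(x ^ 2)⁻¹) (G := fun x ↦ -x⁻¹) (G' := fun x ↦ (x ^ 2)⁻¹)
    (F := fun x ↦ -Real.cos (Real.sqrt (x ^ 2 + μ)))
    (f := fun x ↦ Real.sin (Real.sqrt (x ^ 2 + μ)) * (x / Real.sqrt (x ^ 2 + μ))) huv
    (fun x hx ↦ by simpa using ((hw x hx).cos).fun_neg)
    ((Real.continuous_sin.comp_continuousOn hsq).mul (continuousOn_id.div hsq hne))
    (fun x _ ↦ by simpa using Real.abs_cos_le_one _)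
    (fun x hx ↦ hasDerivAt_inv (hx0 x hx).ne')
    (((continuousOn_id.pow 2).inv₀ fun x hx ↦ pow_ne_zero 2 (hx0 x hx).ne').neg)
    (fun x hx ↦ by simpa using (hasDerivAt_inv (hx0 x hx).ne').fun_neg)
    ((continuousOn_id.pow 2).inv₀ fun x hx ↦ pow_ne_zero 2 (hx0 x hx).ne')
    (fun x _ ↦ by rw [abs_neg, abs_of_nonneg (by positivity)])
  have hcongr : ∫ x in u..v, Real.sinc (Real.sqrt (x ^ 2 + μ)) = ∫ x in u..v,
      x⁻¹ • (Real.sin (Real.sqrt (x ^ 2 + μ)) * (x / Real.sqrt (x ^ 2 + μ))) := by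
    refine intervalIntegral.integral_congr fun x hx ↦ ?_
    rw [Set.uIcc_of_le huv] at hx
    have h1 := hne x hx
    have h2 := (hx0 x hx).ne'
    simp only [Real.sinc_of_ne_zero h1, smul_eq_mul]
    field_simp
  rw [← hcongr, Real.norm_eq_abs] at key
  refine key.trans ?_
  have hu0 : 0 < u := by linarith
  have hv0 : 0 < v := by linarith
  rw [abs_of_pos (inv_pos.2 hu0), abs_of_pos (inv_pos.2 hv0)]
  have := inv_le_one_of_one_le₀ hu
  linarith

theorem abs_integral_sinc_sqrt_sq_add_le_of_one_le {μ u v : ℝ} (hu : 1 ≤ u) (huv : u ≤ v)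
    (hμ : 0 ≤ u ^ 2 + μ) : |∫ x in u..v, Real.sinc (Real.sqrt (x ^ 2 + μ))| ≤ 2 := by
  rcases huv.eq_or_lt with rfl | hlt
  · simp
  refine le_of_forall_pos_le_add fun ε hε ↦ ?_
  -- The square root may vanish at u; a piece of length at most ε is split off there and bounded by
  -- |sinc| ≤ 1.
  set w := min v (u + ε)
  have huw : u < w := lt_min hlt (by linarith)
  have hc := continuous_sinc_sqrt (Q := fun x ↦ x ^ 2 + μ) (by fun_prop)
  rw [← intervalIntegral.integral_add_adjacent_intervals (hc.intervalIntegrable u w)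
    (hc.intervalIntegrable w v)]
  refine (abs_add_le _ _).trans ?_
  have h1 := abs_integral_sinc_sqrt_le_sub (fun x ↦ x ^ 2 + μ) huw.le
  have h2 := abs_integral_sinc_sqrt_sq_add_le_of_pos (μ := μ) (hu.trans huw.le) (min_le_left v _)
    (by nlinarith)
  have h3 : w ≤ u + ε := min_le_right _ _
  linarith

theorem abs_integral_sinc_sqrt_sq_add_le {μ u v : ℝ} (huv : u ≤ v)
    (hμ : ∀ x ∈ Set.Icc u v, 0 ≤ x ^ 2 + μ) :
    |∫ x in u..v, Real.sinc (Real.sqrt (x ^ 2 + μ))| ≤ 6 := by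
  -- The cut points -1 and 1, clamped to [u, v]. The middle piece has length at most 2, and the left
  -- piece is reflected to the right.
  set c := max u (min v (-1))
  set d := max u (min v 1)
  have hc := continuous_sinc_sqrt (Q := fun x ↦ x ^ 2 + μ) (by fun_prop)
  have huc : u ≤ c := le_max_left _ _
  have hcv : c ≤ v := max_le huv (min_le_left _ _)
  have hdv : d ≤ v := max_le huv (min_le_left _ _)
  have hud : u ≤ d := le_max_left _ _
  have hcd : c ≤ d := max_le_max le_rfl (min_le_min le_rfl (by norm_num))
  rw [← intervalIntegral.integral_add_adjacent_intervals (hc.intervalIntegrable u d)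
    (hc.intervalIntegrable d v),
    ← intervalIntegral.integral_add_adjacent_intervals (hc.intervalIntegrable u c)
    (hc.intervalIntegrable c d)]
  have h1 : |∫ x in u..c, Real.sinc (Real.sqrt (x ^ 2 + μ))| ≤ 2 := by
    rcases huc.eq_or_lt with h | h
    · simp [← h]
    have hc1 : c ≤ -1 := by
      rcases max_cases u (min v (-1)) with h' | h'
      · exact absurd h (by simp only [c, h'.1, lt_irrefl, not_false_eq_true])
      · simp only [c, h'.1]; exact min_le_right _ _
    have := intervalIntegral.integral_comp_neg (a := u) (b := c)
      fun x ↦ Real.sinc (Real.sqrt (x ^ 2 + μ))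
    simp only [neg_sq] at this
    rw [this]
    exact abs_integral_sinc_sqrt_sq_add_le_of_one_le (by linarith) (by linarith)
      (by simpa using hμ c ⟨huc, hcv⟩)
  have h2 : |∫ x in c..d, Real.sinc (Real.sqrt (x ^ 2 + μ))| ≤ 2 := by
    refine (abs_integral_sinc_sqrt_le_sub _ hcd).trans ?_
    simp only [c, d]
    grind
  have h3 : |∫ x in d..v, Real.sinc (Real.sqrt (x ^ 2 + μ))| ≤ 2 := by
    rcases hdv.eq_or_lt with h | h
    · simp [h]
    have hd1 : 1 ≤ d := by
      simp only [d] at h ⊢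
      grind
    exact abs_integral_sinc_sqrt_sq_add_le_of_one_le hd1 hdv (hμ d ⟨hud, hdv⟩)
  have h4 := abs_add_three (∫ x in u..c, Real.sinc (Real.sqrt (x ^ 2 + μ)))
    (∫ x in c..d, Real.sinc (Real.sqrt (x ^ 2 + μ))) (∫ x in d..v, Real.sinc (Real.sqrt (x ^ 2 + μ)))
  linarith

theorem abs_integral_sinc_sqrt_affine_le {b c t L σ : ℝ} (ht : t ≠ 0) (h1 : 1 ≤ σ) (hL : σ ≤ L) :
    |∫ s in (1 : ℝ)..σ, Real.sinc (Real.sqrt (b ^ 2 * (s ^ 2 - 1) + (s * c + t) ^ 2))|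
      ≤ 12 * L / |t| := by
  have ht' := abs_pos.2 ht
  set a := Real.sqrt (b ^ 2 + c ^ 2)
  have ha2 : a ^ 2 = b ^ 2 + c ^ 2 := Real.sq_sqrt (by positivity)
  have ha0 : 0 ≤ a := Real.sqrt_nonneg _
  have hca : |c| ≤ a := Real.abs_le_sqrt (by nlinarith)
  -- For small a, |sc + t| ≥ |t|/2 and the integrand itself is O(1/|t|). Otherwise the factor a⁻¹
  -- from rescaling is at most 2L/|t|.
  by_cases hcase : a * L < |t| / 2
  · have hb : ∀ s ∈ Set.uIoc 1 σ,
        ‖Real.sinc (Real.sqrt (b ^ 2 * (s ^ 2 - 1) + (s * c + t) ^ 2))‖ ≤ 2 / |t| := fun s hs ↦ by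
      rw [Set.uIoc_of_le h1] at hs
      have hs1 : 1 < s := hs.1
      have e1 : |s * c| ≤ a * L := by
        rw [abs_mul, mul_comm, abs_of_pos (show 0 < s by linarith)]
        exact mul_le_mul hca (hs.2.trans hL) (by linarith) ha0
      have e2 : |t| / 2 ≤ |s * c + t| := by
        have := abs_sub_abs_le_abs_sub t (-(s * c))
        rw [abs_neg, sub_neg_eq_add, add_comm t] at this
        linarith
      have e3 : |t| / 2 ≤ Real.sqrt (b ^ 2 * (s ^ 2 - 1) + (s * c + t) ^ 2) := by
        refine e2.trans (Real.abs_le_sqrt ?_)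
        have : 0 ≤ b ^ 2 * (s ^ 2 - 1) := mul_nonneg (sq_nonneg _) (by nlinarith)
        linarith
      refine (abs_sinc_le_inv (by linarith)).trans ?_
      rw [show 2 / |t| = (|t| / 2)⁻¹ by rw [inv_div]]
      exact inv_anti₀ (by positivity) e3
    have := intervalIntegral.norm_integral_le_of_norm_le_const hb
    rw [Real.norm_eq_abs, abs_of_nonneg (sub_nonneg.2 h1)] at this
    refine this.trans ?_
    rw [div_mul_eq_mul_div]
    gcongr
    · norm_num
    · linarith
  · have hLpos : 0 < L := by linarith
    have ha : 0 < a := by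
      by_contra h
      have : a = 0 := le_antisymm (not_lt.1 h) ha0
      rw [this, zero_mul] at hcase
      exact hcase (by positivity)
    -- Completing the square in s.
    set μ := t ^ 2 - b ^ 2 - (c * t / a) ^ 2
    have hQ : ∀ s : ℝ, b ^ 2 * (s ^ 2 - 1) + (s * c + t) ^ 2 = (a * s + c * t / a) ^ 2 + μ := by
      intro s
      have : (a * s + c * t / a) ^ 2 = a ^ 2 * s ^ 2 + 2 * s * c * t + (c * t / a) ^ 2 := by
        field_simp
        ring
      simp only [μ]
      rw [this, ha2]
      ring
    simp_rw [hQ]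
    rw [intervalIntegral.integral_comp_mul_add (fun v ↦ Real.sinc (Real.sqrt (v ^ 2 + μ))) ha.ne',
      smul_eq_mul, abs_mul, abs_of_pos (inv_pos.2 ha)]
    have h6 := abs_integral_sinc_sqrt_sq_add_le (μ := μ) (u := a * 1 + c * t / a)
      (v := a * σ + c * t / a) (by gcongr) fun v hv ↦ by
        have hs : v = a * ((v - c * t / a) / a) + c * t / a := by field_simp; ring
        rw [hs, ← hQ]
        have : 1 ≤ (v - c * t / a) / a := by
          rw [le_div_iff₀ ha]; linarith [hv.1]
        have : 0 ≤ b ^ 2 * (((v - c * t / a) / a) ^ 2 - 1) :=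
          mul_nonneg (sq_nonneg _) (by nlinarith)
        positivity
    calc _ ≤ a⁻¹ * 6 := by gcongr
      _ ≤ _ := by
        rw [inv_mul_eq_div, div_le_div_iff₀ ha ht']
        linarith

/-- Provides a cut point even when the level is not attained (r is then an endpoint), which is why
nothing is claimed at r itself. -/
theorem MonotoneOn.exists_level {p q l : ℝ} {D : ℝ → ℝ} (hpq : p ≤ q)
    (hD : MonotoneOn D (Set.Icc p q)) (hc : ContinuousOn D (Set.Icc p q)) :
    ∃ r ∈ Set.Icc p q, (∀ x ∈ Set.Icc p q, x < r → D x ≤ l) ∧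
      (∀ x ∈ Set.Icc p q, r < x → l ≤ D x) := by
  have hp : p ∈ Set.Icc p q := ⟨le_rfl, hpq⟩
  have hq : q ∈ Set.Icc p q := ⟨hpq, le_rfl⟩
  by_cases h1 : l ≤ D p
  · exact ⟨p, hp, fun x hx h ↦ absurd h (not_lt.2 hx.1), fun x hx _ ↦ h1.trans (hD hp hx hx.1)⟩
  by_cases h2 : D q ≤ l
  · exact ⟨q, hq, fun x hx _ ↦ (hD hx hq hx.2).trans h2, fun x hx h ↦ absurd h (not_lt.2 hx.2)⟩
  obtain ⟨r, hr, rfl⟩ := intermediate_value_Icc hpq hc ⟨(not_le.1 h1).le, (not_le.1 h2).le⟩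
  exact ⟨r, hr, fun x hx h ↦ hD hx hr h.le, fun x hx h ↦ hD hr hx h.le⟩

/-! ### Oscillatory integrals with phase ts ± √(a²s² - b²) (sign +) -/

theorem sqrt_sub_pos {a b s : ℝ} (ha : 0 < a) (hb : b ^ 2 ≤ a ^ 2) (hs : 1 < s) :
    0 < Real.sqrt (a ^ 2 * s ^ 2 - b ^ 2) := by
  refine Real.sqrt_pos.2 ?_
  have : 0 < a ^ 2 * (s ^ 2 - 1) := mul_pos (by positivity) (by nlinarith)
  linarith

theorem hasDerivAt_sqrt_sub {a b s : ℝ} (ha : 0 < a) (hb : b ^ 2 ≤ a ^ 2) (hs : 1 < s) :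
    HasDerivAt (fun s ↦ Real.sqrt (a ^ 2 * s ^ 2 - b ^ 2))
      (a ^ 2 * s / Real.sqrt (a ^ 2 * s ^ 2 - b ^ 2)) s := by
  have h0 := sqrt_sub_pos ha hb hs
  have := (((hasDerivAt_pow 2 s).const_mul (a ^ 2)).sub_const (b ^ 2)).sqrt (Real.sqrt_pos.1 h0).ne'
  convert this using 1
  field_simp
  norm_num [mul_comm]

theorem sqrt_sub_le {a b s : ℝ} (ha : 0 < a) (hs : 1 < s) :
    Real.sqrt (a ^ 2 * s ^ 2 - b ^ 2) ≤ a * s := by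
  rw [Real.sqrt_le_left (by positivity)]
  nlinarith [sq_nonneg b]

theorem hasDerivAt_phaseDenom {a b t ε s : ℝ} (ha : 0 < a) (hb : b ^ 2 ≤ a ^ 2) (hs : 1 < s) :
    HasDerivAt (fun s ↦ t * Real.sqrt (a ^ 2 * s ^ 2 - b ^ 2) + ε * (a ^ 2 * s))
      (a ^ 2 * (t * s / Real.sqrt (a ^ 2 * s ^ 2 - b ^ 2) + ε)) s := by
  refine (((hasDerivAt_sqrt_sub ha hb hs).const_mul t).fun_add
    (((hasDerivAt_id' s).const_mul (a ^ 2)).const_mul ε)).congr_deriv ?_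
  ring

/-- Since z = √(a²s² - b²) ≤ as ≤ ts/2, the term ε costs at most half of ts/z. The lower bound is a
multiple of the amplitude 1/z, so short sublevel sets can be measured by the increase of D = tz +
εa²s. -/
theorem phaseDenom_deriv_ge {a b t ε s : ℝ} (ha : 0 < a) (hb : b ^ 2 ≤ a ^ 2) (hε : |ε| ≤ 1)
    (hta : 2 * a ≤ t) (hs : 1 < s) :
    a ^ 2 * t / 2 * (Real.sqrt (a ^ 2 * s ^ 2 - b ^ 2))⁻¹
      ≤ a ^ 2 * (t * s / Real.sqrt (a ^ 2 * s ^ 2 - b ^ 2) + ε) := by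
  have h0 := sqrt_sub_pos ha hb hs
  have h1 := sqrt_sub_le (b := b) ha hs
  set z := Real.sqrt (a ^ 2 * s ^ 2 - b ^ 2)
  have hε' := (abs_le.1 hε).1
  rw [mul_div_assoc, mul_assoc]
  refine mul_le_mul_of_nonneg_left ?_ (sq_nonneg a)
  have h2 : t * s / 2 ≤ t * s + ε * z := by nlinarith
  have h3 : t / 2 ≤ t * s / 2 := by nlinarith
  calc t / 2 * z⁻¹ ≤ (t * s + ε * z) * z⁻¹ := by gcongr; linarith
    _ = t * s / z + ε := by field_simp

theorem continuousOn_sqrt_sub_inv {a b p q : ℝ} (ha : 0 < a) (hb : b ^ 2 ≤ a ^ 2) (hp : 1 < p) :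
    ContinuousOn (fun s ↦ (Real.sqrt (a ^ 2 * s ^ 2 - b ^ 2))⁻¹) (Set.Icc p q) :=
  (by fun_prop : Continuous fun s : ℝ ↦ Real.sqrt (a ^ 2 * s ^ 2 - b ^ 2)).continuousOn.inv₀
    fun _ hs ↦ (sqrt_sub_pos ha hb (hp.trans_le hs.1)).ne'

/-- For the phase Φ = ts + εz, zΦ' = D, so the integrand is D⁻¹ (e^{iΦ})'/i. As D is increasing and
does not vanish, D⁻¹ is monotone, and integration by parts costs at most 4 sup |D⁻¹|. -/
theorem norm_integral_exp_phase_le_of_nonstationary {a b t ε p q δ : ℝ} (ha : 0 < a)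
    (hb : b ^ 2 ≤ a ^ 2) (hε : |ε| ≤ 1) (hta : 2 * a ≤ t) (hp : 1 < p) (hpq : p ≤ q) (hδ : 0 < δ)
    (hD : ∀ s ∈ Set.Ioo p q,
      δ ≤ |t * Real.sqrt (a ^ 2 * s ^ 2 - b ^ 2) + ε * (a ^ 2 * s)|) :
    ‖∫ s in p..q, (Real.sqrt (a ^ 2 * s ^ 2 - b ^ 2))⁻¹ •
      Complex.exp (Complex.I * (t * s + ε * Real.sqrt (a ^ 2 * s ^ 2 - b ^ 2) : ℝ))‖ ≤ 4 / δ := by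
  rcases hpq.eq_or_lt with rfl | hlt
  · simp only [intervalIntegral.integral_same, norm_zero]
    positivity
  set z : ℝ → ℝ := fun s ↦ Real.sqrt (a ^ 2 * s ^ 2 - b ^ 2) with hz
  set D : ℝ → ℝ := fun s ↦ t * z s + ε * (a ^ 2 * s) with hDdef
  have h1 : ∀ s ∈ Set.Icc p q, 1 < s := fun s hs ↦ hp.trans_le hs.1
  have hz0 : ∀ s ∈ Set.Icc p q, z s ≠ 0 := fun s hs ↦ (sqrt_sub_pos ha hb (h1 s hs)).ne'
  have hzc : Continuous z := by simp only [hz]; fun_prop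
  have hzi : ContinuousOn (fun s ↦ (z s)⁻¹) (Set.Icc p q) := continuousOn_sqrt_sub_inv ha hb hp
  have hDc : Continuous D := by simp only [hDdef]; fun_prop
  have hD' : ∀ s ∈ Set.Icc p q, δ ≤ |D s| := by
    rw [← closure_Ioo hlt.ne]
    exact fun s hs ↦ closure_minimal (s := Set.Ioo p q) (t := {s | δ ≤ |D s|}) (fun s hs ↦ hD s hs)
      (isClosed_le continuous_const hDc.abs) hs
  have hDn : ∀ s ∈ Set.Icc p q, D s ≠ 0 := fun s hs h ↦ by
    have := hD' s hs
    rw [h, abs_zero] at this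
    linarith
  have hDd : ∀ s ∈ Set.Icc p q, HasDerivAt D (a ^ 2 * (t * s * (z s)⁻¹ + ε)) s := fun s hs ↦
    hasDerivAt_phaseDenom ha hb (h1 s hs)
  have hDd0 : ∀ s ∈ Set.Icc p q, 0 ≤ a ^ 2 * (t * s * (z s)⁻¹ + ε) := fun s hs ↦ by
    refine le_trans ?_ (phaseDenom_deriv_ge ha hb hε hta (h1 s hs))
    have : 0 ≤ t := by linarith
    positivity
  have hDdc : ContinuousOn (fun s ↦ a ^ 2 * (t * s * (z s)⁻¹ + ε)) (Set.Icc p q) := by fun_prop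
  have hG'c : ContinuousOn (fun s ↦ a ^ 2 * (t * s * (z s)⁻¹ + ε) / D s ^ 2) (Set.Icc p q) :=
    hDdc.div (hDc.continuousOn.pow 2) fun s hs ↦ pow_ne_zero 2 (hDn s hs)
  have key := norm_integral_smul_le_of_antideriv (p := p) (q := q) (M := 1)
    (h := fun s ↦ (D s)⁻¹) (h' := fun s ↦ -(a ^ 2 * (t * s * (z s)⁻¹ + ε)) / D s ^ 2)
    (G := fun s ↦ -(D s)⁻¹) (G' := fun s ↦ a ^ 2 * (t * s * (z s)⁻¹ + ε) / D s ^ 2)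
    (F := fun s ↦ -Complex.I * Complex.exp (Complex.I * (t * s + ε * z s : ℝ)))
    (f := fun s ↦ (t + ε * (a ^ 2 * s * (z s)⁻¹)) •
      Complex.exp (Complex.I * (t * s + ε * z s : ℝ))) hpq
    (fun s hs ↦ by
      have e1 : HasDerivAt (fun s ↦ t * s + ε * z s) (t + ε * (a ^ 2 * s * (z s)⁻¹)) s := by
        refine (((hasDerivAt_id' s).const_mul t).fun_add
          ((hasDerivAt_sqrt_sub ha hb (h1 s hs)).const_mul ε)).congr_deriv ?_
        simp only [hz, div_eq_mul_inv, mul_one]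
      have e2 := ((e1.ofReal_comp.const_mul Complex.I).cexp).const_mul (-Complex.I)
      refine e2.congr_deriv ?_
      rw [Complex.real_smul]
      linear_combination (-Complex.exp (Complex.I * ↑(t * s + ε * z s)) *
        ((t + ε * (a ^ 2 * s * (z s)⁻¹) : ℝ) : ℂ)) * Complex.I_sq)
    (by fun_prop)
    (fun s _ ↦ by
      rw [norm_mul, mul_comm Complex.I, Complex.norm_exp_ofReal_mul_I]
      simp)
    (fun s hs ↦ (hDd s hs).fun_inv (hDn s hs))
    (by simpa only [neg_div] using hG'c.fun_neg)
    (fun s hs ↦ ((hDd s hs).fun_inv (hDn s hs)).fun_neg.congr_deriv (by ring))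
    hG'c
    (fun s hs ↦ by
      rw [neg_div, abs_neg, abs_of_nonneg]
      exact div_nonneg (hDd0 s hs) (sq_nonneg _))
  have hcongr : ∫ s in p..q, (z s)⁻¹ • Complex.exp (Complex.I * (t * s + ε * z s : ℝ)) =
      ∫ s in p..q, (D s)⁻¹ • (t + ε * (a ^ 2 * s * (z s)⁻¹)) •
        Complex.exp (Complex.I * (t * s + ε * z s : ℝ)) := by
    refine intervalIntegral.integral_congr fun s hs ↦ ?_
    rw [Set.uIcc_of_le hpq] at hs
    have n1 := hz0 s hs
    have n2 := hDn s hs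
    simp only [smul_smul]
    congr 1
    field_simp
    simp only [hDdef]
    ring
  rw [hcongr]
  refine key.trans ?_
  have hinv : ∀ s ∈ Set.Icc p q, |(D s)⁻¹| ≤ 1 / δ := fun s hs ↦ by
    rw [abs_inv, ← one_div]
    exact one_div_le_one_div_of_le hδ (hD' s hs)
  have i1 := hinv p ⟨le_rfl, hpq⟩
  have i2 := hinv q ⟨hpq, le_rfl⟩
  have i3 := (abs_le.1 i2).1
  have i4 := (abs_le.1 i1).2
  have : 4 / δ = 4 * (1 / δ) := by ring
  rw [this]
  linarith

/-- A van der Corput argument: the two intervals with |D| ≥ δ are nonstationary and cost 4/δ each;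
between them 1/z ≤ 2D'/(a²t), while D grows by at most 2δ. -/
theorem norm_integral_exp_phase_le {a b t ε p q δ : ℝ} (ha : 0 < a)
    (hb : b ^ 2 ≤ a ^ 2) (hε : |ε| ≤ 1) (hta : 2 * a ≤ t) (hp : 1 < p) (hpq : p ≤ q) (hδ : 0 < δ) :
    ‖∫ s in p..q, (Real.sqrt (a ^ 2 * s ^ 2 - b ^ 2))⁻¹ •
      Complex.exp (Complex.I * (t * s + ε * Real.sqrt (a ^ 2 * s ^ 2 - b ^ 2) : ℝ))‖
      ≤ 8 / δ + 4 * δ / (a ^ 2 * t) := by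
  have ht : 0 < t := by linarith
  set z : ℝ → ℝ := fun s ↦ Real.sqrt (a ^ 2 * s ^ 2 - b ^ 2) with hz
  set D : ℝ → ℝ := fun s ↦ t * z s + ε * (a ^ 2 * s) with hDdef
  have h1 : ∀ s ∈ Set.Icc p q, 1 < s := fun s hs ↦ hp.trans_le hs.1
  have hzc : Continuous z := by simp only [hz]; fun_prop
  have hzi : ContinuousOn (fun s ↦ (z s)⁻¹) (Set.Icc p q) := continuousOn_sqrt_sub_inv ha hb hp
  have hDc : Continuous D := by simp only [hDdef]; fun_prop
  have hDd : ∀ s ∈ Set.Icc p q, HasDerivAt D (a ^ 2 * (t * s * (z s)⁻¹ + ε)) s := fun s hs ↦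
    hasDerivAt_phaseDenom ha hb (h1 s hs)
  have hDge : ∀ s ∈ Set.Icc p q, a ^ 2 * t / 2 * (z s)⁻¹ ≤ a ^ 2 * (t * s * (z s)⁻¹ + ε) :=
    fun s hs ↦ phaseDenom_deriv_ge ha hb hε hta (h1 s hs)
  have hDdc : ContinuousOn (fun s ↦ a ^ 2 * (t * s * (z s)⁻¹ + ε)) (Set.Icc p q) := by fun_prop
  have hmono : MonotoneOn D (Set.Icc p q) := by
    refine monotoneOn_of_hasDerivWithinAt_nonneg (convex_Icc p q) hDc.continuousOn
      (fun s hs ↦ (hDd s (interior_subset hs)).hasDerivWithinAt) fun s hs ↦ ?_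
    refine le_trans ?_ (hDge s (interior_subset hs))
    have := sqrt_sub_pos ha hb (h1 s (interior_subset hs))
    positivity
  obtain ⟨c, hc, hc1, hc2⟩ := hmono.exists_level (l := -δ) hpq hDc.continuousOn
  obtain ⟨d, hd, hd1, hd2⟩ := (hmono.mono (Set.Icc_subset_Icc_left hc.1)).exists_level (l := δ)
    hc.2 hDc.continuousOn
  have hfc : ContinuousOn
      (fun s ↦ (z s)⁻¹ • Complex.exp (Complex.I * (t * s + ε * z s : ℝ))) (Set.Icc p q) := by
    fun_prop
  have hint : ∀ u v, p ≤ u → u ≤ v → v ≤ q → IntervalIntegrable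
      (fun s ↦ (z s)⁻¹ • Complex.exp (Complex.I * (t * s + ε * z s : ℝ))) volume u v :=
    fun u v hu huv hv ↦ ContinuousOn.intervalIntegrable
      (hfc.mono (by rw [Set.uIcc_of_le huv]; exact Set.Icc_subset_Icc hu hv))
  have n1 := norm_integral_exp_phase_le_of_nonstationary ha hb hε hta hp hc.1 hδ
    fun s hs ↦ by
      have := hc1 s ⟨hs.1.le, hs.2.le.trans hc.2⟩ hs.2
      exact le_abs.2 (Or.inr (by linarith))
  have n3 := norm_integral_exp_phase_le_of_nonstationary ha hb hε hta
    (hp.trans_le (hc.1.trans hd.1)) hd.2 hδ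
    fun s hs ↦ by
      have := hd2 s ⟨hd.1.trans hs.1.le, hs.2.le⟩ hs.1
      exact le_abs.2 (Or.inl this)
  have n2 : ‖∫ s in c..d, (z s)⁻¹ • Complex.exp (Complex.I * (t * s + ε * z s : ℝ))‖
      ≤ 4 * δ / (a ^ 2 * t) := by
    rcases hd.1.eq_or_lt with h | h
    · rw [← h]
      simp only [intervalIntegral.integral_same, norm_zero]
      positivity
    have hsub : Set.Icc c d ⊆ Set.Icc p q := Set.Icc_subset_Icc hc.1 hd.2
    have b1 : ‖∫ s in c..d, (z s)⁻¹ • Complex.exp (Complex.I * (t * s + ε * z s : ℝ))‖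
        ≤ ∫ s in c..d, 2 / (a ^ 2 * t) * (a ^ 2 * (t * s * (z s)⁻¹ + ε)) := by
      refine intervalIntegral.norm_integral_le_of_norm_le hd.1 ?_ ?_
      · refine Filter.Eventually.of_forall fun s hs ↦ ?_
        have hs' := hsub (Set.Ioc_subset_Icc_self hs)
        have hzp : 0 < z s := sqrt_sub_pos ha hb (h1 s hs')
        rw [norm_smul, mul_comm Complex.I, Complex.norm_exp_ofReal_mul_I, mul_one,
          Real.norm_of_nonneg (inv_nonneg.2 hzp.le)]
        calc (z s)⁻¹ = 2 / (a ^ 2 * t) * (a ^ 2 * t / 2 * (z s)⁻¹) := by field_simp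
          _ ≤ _ := mul_le_mul_of_nonneg_left (hDge s hs') (by positivity)
      · refine (ContinuousOn.intervalIntegrable ?_).const_mul _
        rw [Set.uIcc_of_le hd.1]
        exact hDdc.mono hsub
    rw [intervalIntegral.integral_const_mul, intervalIntegral.integral_eq_sub_of_hasDerivAt
      (f := D) (fun s hs ↦ hDd s (hsub (by rwa [Set.uIcc_of_le hd.1] at hs)))
      (ContinuousOn.intervalIntegrable (by rw [Set.uIcc_of_le hd.1]; exact hDdc.mono hsub))] at b1
    -- The cut points carry no information themselves; the bounds at c and d are limits from inside
    -- the nondegenerate interval.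
    have hDC : -δ ≤ D c := by
      have : c ∈ closure (Set.Ioo c d) := by rw [closure_Ioo h.ne]; exact ⟨le_rfl, h.le⟩
      exact closure_minimal (t := {s | -δ ≤ D s})
        (fun s hs ↦ hc2 s ⟨hc.1.trans hs.1.le, hs.2.le.trans hd.2⟩ hs.1)
        (isClosed_le continuous_const hDc) this
    have hDD : D d ≤ δ := by
      have : d ∈ closure (Set.Ioo c d) := by rw [closure_Ioo h.ne]; exact ⟨h.le, le_rfl⟩
      exact closure_minimal (t := {s | D s ≤ δ})
        (fun s hs ↦ hd1 s ⟨hs.1.le, hs.2.le.trans hd.2⟩ hs.2)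
        (isClosed_le hDc continuous_const) this
    refine b1.trans ?_
    calc 2 / (a ^ 2 * t) * (D d - D c) ≤ 2 / (a ^ 2 * t) * (2 * δ) := by gcongr; linarith
      _ = _ := by ring
  rw [← intervalIntegral.integral_add_adjacent_intervals (hint p d le_rfl (hc.1.trans hd.1) hd.2)
    (hint d q (hc.1.trans hd.1) hd.2 le_rfl),
    ← intervalIntegral.integral_add_adjacent_intervals (hint p c le_rfl hc.1 hc.2)
    (hint c d hc.1 hd.1 hd.2)]
  refine (norm_add₃_le).trans ?_
  have : 8 / δ = 4 / δ + 4 / δ := by ring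
  rw [this]
  linarith

theorem norm_integral_sinc_smul_exp_le_of_phase {a b t p q : ℝ} (ha : 0 < a) (hb : b ^ 2 ≤ a ^ 2)
    (hp : 1 < p) (hpq : p ≤ q) {B : ℝ}
    (hB : ∀ ε : ℝ, |ε| ≤ 1 → ‖∫ s in p..q, (Real.sqrt (a ^ 2 * s ^ 2 - b ^ 2))⁻¹ •
      Complex.exp (Complex.I * (t * s + ε * Real.sqrt (a ^ 2 * s ^ 2 - b ^ 2) : ℝ))‖ ≤ B) :
    ‖∫ s in p..q, Real.sinc (Real.sqrt (a ^ 2 * s ^ 2 - b ^ 2)) •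
      Complex.exp (Complex.I * (t * s : ℝ))‖ ≤ B := by
  set z : ℝ → ℝ := fun s ↦ Real.sqrt (a ^ 2 * s ^ 2 - b ^ 2) with hz
  have hzc : Continuous z := by simp only [hz]; fun_prop
  have hzi : ContinuousOn (fun s ↦ (z s)⁻¹) (Set.Icc p q) := continuousOn_sqrt_sub_inv ha hb hp
  have hint : ∀ ε : ℝ, IntervalIntegrable
      (fun s ↦ (z s)⁻¹ • Complex.exp (Complex.I * (t * s + ε * z s : ℝ))) volume p q := fun ε ↦ by
    refine ContinuousOn.intervalIntegrable ?_
    rw [Set.uIcc_of_le hpq]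
    fun_prop
  -- Euler's formula for sin z splits the integrand into the phases with ε = 1 and ε = -1.
  have hcongr : ∫ s in p..q, Real.sinc (z s) • Complex.exp (Complex.I * (t * s : ℝ)) =
      ∫ s in p..q, (-Complex.I / 2) *
        ((z s)⁻¹ • Complex.exp (Complex.I * (t * s + 1 * z s : ℝ)) -
          (z s)⁻¹ • Complex.exp (Complex.I * (t * s + (-1) * z s : ℝ))) := by
    refine intervalIntegral.integral_congr fun s hs ↦ ?_
    rw [Set.uIcc_of_le hpq] at hs
    have h0 : z s ≠ 0 := (sqrt_sub_pos ha hb (hp.trans_le hs.1)).ne'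
    simp only [Real.sinc_of_ne_zero h0, Complex.real_smul]
    have e1 : Complex.exp (Complex.I * (t * s + 1 * z s : ℝ)) =
        Complex.exp (Complex.I * (t * s : ℝ)) * Complex.exp (z s * Complex.I) := by
      rw [← Complex.exp_add]; congr 1; push_cast; ring
    have e2 : Complex.exp (Complex.I * (t * s + (-1) * z s : ℝ)) =
        Complex.exp (Complex.I * (t * s : ℝ)) * Complex.exp (-z s * Complex.I) := by
      rw [← Complex.exp_add]; congr 1; push_cast; ring
    rw [e1, e2]
    push_cast
    rw [Complex.sin]
    ring
  rw [hcongr, intervalIntegral.integral_const_mul,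
    intervalIntegral.integral_sub (hint 1) (hint (-1)), norm_mul]
  have h2 := hB 1 (by simp)
  have h3 := hB (-1) (by simp)
  have h4 := norm_sub_le
    (∫ s in p..q, (z s)⁻¹ • Complex.exp (Complex.I * (t * s + 1 * z s : ℝ)))
    (∫ s in p..q, (z s)⁻¹ • Complex.exp (Complex.I * (t * s + (-1) * z s : ℝ)))
  have h5 : ‖-Complex.I / 2‖ = 1 / 2 := by simp
  rw [h5]
  linarith

theorem hasDerivAt_exp_I_mul_div {t : ℝ} (ht : t ≠ 0) (s : ℝ) :
    HasDerivAt (fun s : ℝ ↦ -Complex.I / t * Complex.exp (Complex.I * (t * s : ℝ)))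
      (Complex.exp (Complex.I * (t * s : ℝ))) s := by
  have e1 : HasDerivAt (fun s : ℝ ↦ t * s) t s := by
    simpa using (hasDerivAt_id' s).const_mul t
  refine (((e1.ofReal_comp.const_mul Complex.I).cexp).const_mul (-Complex.I / t)).congr_deriv ?_
  have : (t : ℂ) ≠ 0 := by exact_mod_cast ht
  field_simp
  rw [Complex.I_sq]
  ring

theorem norm_exp_I_mul_div {t : ℝ} (ht : 0 < t) (s : ℝ) :
    ‖-Complex.I / t * Complex.exp (Complex.I * (t * s : ℝ))‖ ≤ 1 / t := by
  rw [norm_mul, mul_comm Complex.I, Complex.norm_exp_ofReal_mul_I]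
  simp [abs_of_pos ht]

/-- Here only e^{its} is integrated. For 0 < z ≤ 1 the derivative of sinc is bounded by 1, so the
variation of sinc z is at most that of the increasing function z, hence at most 1. -/
theorem norm_integral_sinc_smul_exp_le_of_small {a b t p q : ℝ} (ha : 0 < a) (hb : b ^ 2 ≤ a ^ 2)
    (ht : 0 < t) (hp : 1 < p) (hpq : p ≤ q)
    (hz1 : ∀ s ∈ Set.Ioo p q, Real.sqrt (a ^ 2 * s ^ 2 - b ^ 2) ≤ 1) :
    ‖∫ s in p..q, Real.sinc (Real.sqrt (a ^ 2 * s ^ 2 - b ^ 2)) •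
      Complex.exp (Complex.I * (t * s : ℝ))‖ ≤ 3 / t := by
  rcases hpq.eq_or_lt with rfl | hlt
  · simp only [intervalIntegral.integral_same, norm_zero]
    positivity
  set z : ℝ → ℝ := fun s ↦ Real.sqrt (a ^ 2 * s ^ 2 - b ^ 2) with hz
  have h1 : ∀ s ∈ Set.Icc p q, 1 < s := fun s hs ↦ hp.trans_le hs.1
  have hz0 : ∀ s ∈ Set.Icc p q, 0 < z s := fun s hs ↦ sqrt_sub_pos ha hb (h1 s hs)
  have hzn : ∀ s ∈ Set.Icc p q, z s ≠ 0 := fun s hs ↦ (hz0 s hs).ne'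
  have hzc : Continuous z := by simp only [hz]; fun_prop
  have hzi : ContinuousOn (fun s ↦ (z s)⁻¹) (Set.Icc p q) := continuousOn_sqrt_sub_inv ha hb hp
  have hzle : ∀ s ∈ Set.Icc p q, z s ≤ 1 := by
    rw [← closure_Ioo hlt.ne]
    exact fun s hs ↦ closure_minimal (s := Set.Ioo p q) (t := {s | z s ≤ 1}) (fun s hs ↦ hz1 s hs)
      (isClosed_le hzc continuous_const) hs
  have hzd : ∀ s ∈ Set.Icc p q, HasDerivAt z (a ^ 2 * s * (z s)⁻¹) s := fun s hs ↦
    hasDerivAt_sqrt_sub ha hb (h1 s hs)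
  have key := norm_integral_smul_le_of_antideriv (p := p) (q := q) (M := 1 / t)
    (h := fun s ↦ Real.sin (z s) * (z s)⁻¹)
    (h' := fun s ↦ (Real.cos (z s) * (z s)⁻¹ - Real.sin (z s) * ((z s)⁻¹) ^ 2) *
      (a ^ 2 * s * (z s)⁻¹))
    (G := z) (G' := fun s ↦ a ^ 2 * s * (z s)⁻¹)
    (F := fun s : ℝ ↦ -Complex.I / t * Complex.exp (Complex.I * (t * s : ℝ)))
    (f := fun s : ℝ ↦ Complex.exp (Complex.I * (t * s : ℝ))) hpq
    (fun s _ ↦ hasDerivAt_exp_I_mul_div ht.ne' s) (by fun_prop)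
    (fun s _ ↦ norm_exp_I_mul_div ht s)
    (fun s hs ↦ ((hzd s hs).sin.mul ((hzd s hs).fun_inv (hzn s hs))).congr_deriv (by
      have := hzn s hs
      field_simp
      ring))
    (by fun_prop) hzd (by fun_prop)
    (fun s hs ↦ by
      have p1 := hz0 s hs
      have p2 := hzle s hs
      have p3 : 0 ≤ a ^ 2 * s * (z s)⁻¹ := by have := h1 s hs; positivity
      rw [abs_mul, abs_of_nonneg p3]
      refine mul_le_of_le_one_left p3 ?_
      have e : Real.cos (z s) * (z s)⁻¹ - Real.sin (z s) * ((z s)⁻¹) ^ 2 =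
          (z s * Real.cos (z s) - Real.sin (z s)) / (z s) ^ 2 := by field_simp
      rw [e, abs_div, abs_of_pos (by positivity : 0 < z s ^ 2), div_le_one (by positivity)]
      have q1 := Real.one_sub_sq_div_two_le_cos (x := z s)
      have q2 := Real.sin_gt_sub_cube p1
      have q3 := Real.sin_lt p1
      have q4 := Real.cos_le_one (z s)
      have q5 : z s ^ 3 ≤ z s ^ 2 := pow_le_pow_of_le_one p1.le p2 (by norm_num)
      have q6 : 0 < z s ^ 3 := by positivity
      rw [abs_le]
      constructor
      · nlinarith
      · nlinarith)
  have hcongr : ∫ s in p..q, Real.sinc (z s) • Complex.exp (Complex.I * (t * s : ℝ)) =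
      ∫ s in p..q, (Real.sin (z s) * (z s)⁻¹) • Complex.exp (Complex.I * (t * s : ℝ)) := by
    refine intervalIntegral.integral_congr fun s hs ↦ ?_
    rw [Set.uIcc_of_le hpq] at hs
    simp only [Real.sinc_of_ne_zero (hzn s hs), div_eq_mul_inv]
  rw [hcongr]
  refine key.trans ?_
  have hs1 : ∀ s ∈ Set.Icc p q, |Real.sin (z s) * (z s)⁻¹| ≤ 1 := fun s hs ↦ by
    rw [← div_eq_mul_inv, ← Real.sinc_of_ne_zero (hzn s hs)]
    exact Real.abs_sinc_le_one _
  have i1 := hs1 p ⟨le_rfl, hpq⟩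
  have i2 := hs1 q ⟨hpq, le_rfl⟩
  have i3 := hzle q ⟨hpq, le_rfl⟩
  have i4 := hz0 p ⟨le_rfl, hpq⟩
  calc _ ≤ 1 / t * 3 := by gcongr; linarith
    _ = 3 / t := by ring

theorem norm_integral_sinc_smul_exp_le_of_lt {a b t p q : ℝ} (ha : 0 < a) (hb0 : 0 ≤ b)
    (hb : b ≤ a) (hta : 2 * a ≤ t) (hp : 1 < p) (hpq : p ≤ q) :
    ‖∫ s in p..q, Real.sinc (Real.sqrt (a ^ 2 * s ^ 2 - b ^ 2)) •
      Complex.exp (Complex.I * (t * s : ℝ))‖ ≤ 24 / t := by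
  have ht : 0 < t := by linarith
  have hb2 : b ^ 2 ≤ a ^ 2 := by nlinarith
  -- If a² ≥ t/4, the choice δ = a√t makes both terms of the van der Corput bound of order 1/(a√t),
  -- which is O(1/t). If a² < t/4, the interval is cut where z = 1.
  by_cases hcase : t / 4 ≤ a ^ 2
  · refine norm_integral_sinc_smul_exp_le_of_phase ha hb2 hp hpq fun ε hε ↦ ?_
    have hst : 0 < Real.sqrt t := Real.sqrt_pos.2 ht
    have hsq : Real.sqrt t ^ 2 = t := Real.sq_sqrt ht.le
    refine (norm_integral_exp_phase_le ha hb2 hε hta hp hpq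
      (δ := a * Real.sqrt t) (by positivity)).trans ?_
    have e : 8 / (a * Real.sqrt t) + 4 * (a * Real.sqrt t) / (a ^ 2 * t) =
        12 / (a * Real.sqrt t) := by
      nth_rewrite 3 [← hsq]
      field_simp
      norm_num
    rw [e, div_le_div_iff₀ (by positivity) ht]
    have h2 : Real.sqrt t ≤ 2 * a := by
      rw [Real.sqrt_le_left (by positivity)]
      nlinarith
    nlinarith
  · push Not at hcase
    have hzc : Continuous fun s ↦ Real.sqrt (a ^ 2 * s ^ 2 - b ^ 2) := by fun_prop
    have hmono : MonotoneOn (fun s ↦ Real.sqrt (a ^ 2 * s ^ 2 - b ^ 2)) (Set.Icc p q) := by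
      intro x hx y hy hxy
      have : 0 ≤ x := by linarith [hx.1]
      dsimp only
      gcongr
    obtain ⟨r, hr, hr1, hr2⟩ := hmono.exists_level (l := 1) hpq hzc.continuousOn
    have hfc : Continuous fun s : ℝ ↦ Real.sinc (Real.sqrt (a ^ 2 * s ^ 2 - b ^ 2)) •
        Complex.exp (Complex.I * (t * s : ℝ)) :=
      (continuous_sinc_sqrt (by fun_prop)).smul (by fun_prop)
    rw [← intervalIntegral.integral_add_adjacent_intervals (hfc.intervalIntegrable p r)
      (hfc.intervalIntegrable r q)]
    refine (norm_add_le _ _).trans ?_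
    have n1 := norm_integral_sinc_smul_exp_le_of_small ha hb2 ht hp hr.1
      fun s hs ↦ hr1 s ⟨hs.1.le, hs.2.le.trans hr.2⟩ hs.2
    have n2 := norm_integral_sinc_smul_exp_le_of_phase (t := t) ha hb2 (hp.trans_le hr.1) hr.2
      fun ε hε ↦ norm_integral_exp_phase_le_of_nonstationary ha hb2 hε hta (hp.trans_le hr.1) hr.2
        (δ := t / 4) (by positivity) fun s hs ↦ by
          have hz1 := hr2 s ⟨hr.1.trans hs.1.le, hs.2.le⟩ hs.1
          have hs1 : 1 < s := (hp.trans_le hr.1).trans hs.1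
          have hsq : Real.sqrt (a ^ 2 * s ^ 2 - b ^ 2) ^ 2 = a ^ 2 * s ^ 2 - b ^ 2 :=
            Real.sq_sqrt (Real.sqrt_pos.1 (sqrt_sub_pos ha hb2 hs1)).le
          set z := Real.sqrt (a ^ 2 * s ^ 2 - b ^ 2)
          -- With b ≤ a ≤ t/2, a² < t/4 and z ≥ 1 this yields a²s ≤ az + a² ≤ (3/4)tz, so D ≥ tz/4 ≥
          -- t/4.
          have e1 : a * s ≤ z + b := by
            refine abs_le_of_sq_le_sq' ?_ (by linarith) |>.2
            nlinarith
          have e2 : a ^ 2 * s ≤ 3 / 4 * (t * z) := by nlinarith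
          have e3 : 0 ≤ a ^ 2 * s := by positivity
          have e4 := (abs_le.1 hε).1
          refine le_trans ?_ (le_abs_self _)
          nlinarith
    have e : 24 / t = 3 / t + 4 / (t / 4) + 5 / t := by field_simp; norm_num
    have : 0 < 5 / t := by positivity
    linarith

theorem norm_integral_sinc_smul_exp_le_of_pos {a b t L σ : ℝ} (hb0 : 0 ≤ b) (hb : b ≤ a)
    (ht : 0 < t) (h1 : 1 ≤ σ) (hL : σ ≤ L) :
    ‖∫ s in (1 : ℝ)..σ, Real.sinc (Real.sqrt (a ^ 2 * s ^ 2 - b ^ 2)) •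
      Complex.exp (Complex.I * (t * s : ℝ))‖ ≤ 24 * L / t := by
  have hb2 : b ^ 2 ≤ a ^ 2 := by nlinarith
  have hL1 : 1 ≤ L := h1.trans hL
  have hfc : Continuous fun s : ℝ ↦ Real.sinc (Real.sqrt (a ^ 2 * s ^ 2 - b ^ 2)) •
      Complex.exp (Complex.I * (t * s : ℝ)) :=
    (continuous_sinc_sqrt (by fun_prop)).smul (by fun_prop)
  rcases (hb0.trans hb).eq_or_lt with ha | ha
  · have hb' : b = 0 := by linarith
    subst hb' ha
    have e : ∀ s : ℝ, Real.sinc (Real.sqrt ((0 : ℝ) ^ 2 * s ^ 2 - 0 ^ 2)) = 1 := by simp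
    simp_rw [e, one_smul]
    rw [intervalIntegral.integral_eq_sub_of_hasDerivAt
      (fun s _ ↦ hasDerivAt_exp_I_mul_div ht.ne' s)
      (Continuous.intervalIntegrable (by fun_prop) _ _)]
    refine (norm_sub_le _ _).trans ((add_le_add (norm_exp_I_mul_div ht _)
      (norm_exp_I_mul_div ht _)).trans ?_)
    rw [← add_div]
    gcongr
    linarith
  rcases le_total (2 * a) t with hta | hta
  · have h24 : 24 / t ≤ 24 * L / t := by gcongr; linarith
    refine le_trans ?_ h24
    rcases h1.eq_or_lt with rfl | hlt
    · simp only [intervalIntegral.integral_same, norm_zero]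
      positivity
    refine le_of_forall_pos_le_add fun ε hε ↦ ?_
    -- When a = b, z vanishes at s = 1, so a piece of length at most ε is estimated trivially.
    set w := min σ (1 + ε)
    have hw : 1 < w := lt_min hlt (by linarith)
    rw [← intervalIntegral.integral_add_adjacent_intervals (hfc.intervalIntegrable 1 w)
      (hfc.intervalIntegrable w σ)]
    refine (norm_add_le _ _).trans ?_
    have n1 := norm_integral_sinc_smul_exp_le_of_lt ha hb0 hb hta hw (min_le_left σ _)
    have n2 := intervalIntegral.norm_integral_le_of_norm_le_const (a := 1) (b := w) (C := 1)
      (f := fun s : ℝ ↦ Real.sinc (Real.sqrt (a ^ 2 * s ^ 2 - b ^ 2)) •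
        Complex.exp (Complex.I * (t * s : ℝ))) fun s _ ↦ by
          rw [norm_smul, mul_comm Complex.I, Complex.norm_exp_ofReal_mul_I, mul_one]
          exact Real.abs_sinc_le_one _
    rw [abs_of_pos (by linarith)] at n2
    have n3 : w ≤ 1 + ε := min_le_right _ _
    linarith
  -- For t ≤ 2a no oscillation is needed: z ≥ a√(s - 1), so |sinc z| is integrable with integral
  -- O(L/a), which is O(L/t).
  · have hmain : ‖∫ s in (1 : ℝ)..σ, Real.sinc (Real.sqrt (a ^ 2 * s ^ 2 - b ^ 2)) •
        Complex.exp (Complex.I * (t * s : ℝ))‖ ≤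
        ∫ s in (1 : ℝ)..σ, a⁻¹ * (s - 1) ^ (-(1 / 2) : ℝ) := by
      have hi : IntervalIntegrable (fun s : ℝ ↦ (s - 1) ^ (-(1 / 2) : ℝ)) volume 1 σ := by
        have := (intervalIntegral.intervalIntegrable_rpow' (a := 0) (b := σ - 1)
          (r := (-(1 / 2) : ℝ)) (by norm_num)).comp_sub_right 1
        simpa using this
      refine intervalIntegral.norm_integral_le_of_norm_le h1 ?_ (hi.const_mul _)
      refine Filter.Eventually.of_forall fun s hs ↦ ?_
      have hs1 : 0 < s - 1 := by linarith [hs.1]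
      have hz := sqrt_sub_pos ha hb2 hs.1
      rw [norm_smul, mul_comm Complex.I, Complex.norm_exp_ofReal_mul_I, mul_one, Real.norm_eq_abs]
      refine (abs_sinc_le_inv hz).trans ?_
      rw [Real.rpow_neg hs1.le, ← Real.sqrt_eq_rpow, ← mul_inv]
      refine inv_anti₀ (mul_pos ha (Real.sqrt_pos.2 hs1)) ?_
      refine Real.le_sqrt_of_sq_le ?_
      rw [mul_pow, Real.sq_sqrt hs1.le]
      have : a ^ 2 * (s - 1) ≤ a ^ 2 * (s ^ 2 - 1) := by gcongr; nlinarith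
      linarith
    refine hmain.trans ?_
    rw [intervalIntegral.integral_const_mul,
      intervalIntegral.integral_comp_sub_right (fun s : ℝ ↦ s ^ (-(1 / 2) : ℝ)),
      integral_rpow (Or.inl (by norm_num))]
    norm_num
    rw [← Real.sqrt_eq_rpow]
    have hs : Real.sqrt (σ - 1) ≤ L := by
      rw [Real.sqrt_le_left (by linarith)]
      nlinarith
    rw [inv_mul_eq_div, div_le_div_iff₀ ha ht]
    have := Real.sqrt_nonneg (σ - 1)
    nlinarith

theorem norm_integral_sinc_smul_exp_le {a b t L σ : ℝ} (hb0 : 0 ≤ b) (hb : b ≤ a)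
    (ht : t ≠ 0) (h1 : 1 ≤ σ) (hL : σ ≤ L) :
    ‖∫ s in (1 : ℝ)..σ, Real.sinc (Real.sqrt (a ^ 2 * s ^ 2 - b ^ 2)) •
      Complex.exp (Complex.I * (t * s : ℝ))‖ ≤ 24 * L / |t| := by
  rcases ht.lt_or_gt with h | h
  · have := norm_integral_sinc_smul_exp_le_of_pos hb0 hb (neg_pos.2 h) h1 hL
    rw [abs_of_neg h]
    refine le_of_eq_of_le ?_ this
    rw [intervalIntegral.integral_of_le h1, intervalIntegral.integral_of_le h1,
      ← Complex.norm_conj, ← integral_conj]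
    congr 2
    ext s
    simp only [Complex.real_smul, map_mul, Complex.conj_ofReal, ← Complex.exp_conj, Complex.conj_I]
    push_cast
    ring_nf
  · rw [abs_of_pos h]
    exact norm_integral_sinc_smul_exp_le_of_pos hb0 hb h h1 hL

/-! ### The Fourier transform of the surface measure of the unit sphere -/

theorem HasFDerivAt.hasDerivAt_fst {f : ℝ × ℝ → ℂ} {f' : ℝ × ℝ →L[ℝ] ℂ} {p : ℝ × ℝ}
    (hf : HasFDerivAt f f' p) : HasDerivAt (fun x ↦ f (x, p.2)) (f' (1, 0)) p.1 :=
  HasFDerivAt.comp_hasDerivAt p.1 (f := fun x ↦ (x, p.2)) hf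
    ((hasDerivAt_id p.1).prodMk (hasDerivAt_const p.1 p.2))

theorem HasFDerivAt.hasDerivAt_snd {f : ℝ × ℝ → ℂ} {f' : ℝ × ℝ →L[ℝ] ℂ} {p : ℝ × ℝ}
    (hf : HasFDerivAt f f' p) : HasDerivAt (fun x ↦ f (p.1, x)) (f' (0, 1)) p.2 :=
  HasFDerivAt.comp_hasDerivAt p.2 (f := fun x ↦ (p.1, x)) hf
    ((hasDerivAt_const p.2 p.1).prodMk (hasDerivAt_id p.2))

theorem hasDerivAt_sphere_wave (r α : ℝ) (p : ℝ × ℝ) :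
    HasDerivAt (fun α : ℝ ↦ Real.sin p.1 * Complex.exp (Complex.I *
        (r * (Real.sin α * (Real.sin p.1 * Real.cos p.2) + Real.cos α * Real.cos p.1) : ℝ)))
      (Complex.I * (r * (Real.cos α * (Real.sin p.1 * Real.cos p.2) -
          Real.sin α * Real.cos p.1) : ℝ) * (Real.sin p.1 * Complex.exp (Complex.I *
        (r * (Real.sin α * (Real.sin p.1 * Real.cos p.2) + Real.cos α * Real.cos p.1) : ℝ)))) α := by
  have e1 : HasDerivAt (fun α : ℝ ↦ r * (Real.sin α * (Real.sin p.1 * Real.cos p.2) +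
      Real.cos α * Real.cos p.1)) (r * (Real.cos α * (Real.sin p.1 * Real.cos p.2) -
          Real.sin α * Real.cos p.1)) α := by
    refine ((((Real.hasDerivAt_sin α).mul_const _).fun_add
      ((Real.hasDerivAt_cos α).mul_const _)).const_mul r).congr_deriv ?_
    ring
  refine (((e1.ofReal_comp.const_mul Complex.I).cexp).const_mul _).congr_deriv ?_
  ring

/-- The α-derivative is the action of an infinitesimal rotation, -cos φ ∂_θ + cot θ sin φ ∂_φ.
Multiplied by sin θ this field is divergence free, so the integrand is a divergence; the boundary
fluxes vanish because sin θ = 0 at θ = 0, π and sin φ = 0 at φ = ±π. -/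
theorem integral_sphere_wave_deriv_eq_zero (r α : ℝ) :
    ∫ p in Set.Icc ((0, -Real.pi) : ℝ × ℝ) (Real.pi, Real.pi),
      Complex.I * (r * (Real.cos α * (Real.sin p.1 * Real.cos p.2) -
          Real.sin α * Real.cos p.1) : ℝ) * (Real.sin p.1 * Complex.exp (Complex.I *
        (r * (Real.sin α * (Real.sin p.1 * Real.cos p.2) + Real.cos α * Real.cos p.1) : ℝ))) = 0 := by
  set f : ℝ × ℝ → ℂ := fun p ↦ Complex.exp (Complex.I *
    (r * (Real.sin α * (Real.sin p.1 * Real.cos p.2) + Real.cos α * Real.cos p.1) : ℝ)) with hf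
  set A : ℝ × ℝ → ℂ := fun p ↦ ((-(Real.sin p.1 * Real.cos p.2) : ℝ) : ℂ) * f p with hA
  set B : ℝ × ℝ → ℂ := fun p ↦ ((Real.cos p.1 * Real.sin p.2 : ℝ) : ℂ) * f p with hB
  have hofR : ContDiff ℝ 1 (fun x : ℝ ↦ (x : ℂ)) := Complex.ofRealCLM.contDiff
  have hfd : ContDiff ℝ 1 f := by
    refine Complex.contDiff_exp.comp (contDiff_const.mul (hofR.comp ?_))
    fun_prop
  have hAd : ContDiff ℝ 1 A := by
    refine (hofR.comp (g := fun x : ℝ ↦ (x : ℂ)) ?_).mul hfd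
    fun_prop
  have hBd : ContDiff ℝ 1 B := by
    refine (hofR.comp (g := fun x : ℝ ↦ (x : ℂ)) ?_).mul hfd
    fun_prop
  have hAf : ∀ p, HasFDerivAt A (fderiv ℝ A p) p :=
    fun p ↦ (hAd.differentiable (by norm_num) p).hasFDerivAt
  have hBf : ∀ p, HasFDerivAt B (fderiv ℝ B p) p :=
    fun p ↦ (hBd.differentiable (by norm_num) p).hasFDerivAt
  have hA1 : ∀ p, fderiv ℝ A p (1, 0) = ((-(Real.cos p.1 * Real.cos p.2) : ℝ) : ℂ) * f p +
      ((-(Real.sin p.1 * Real.cos p.2) : ℝ) : ℂ) * (f p * (Complex.I * (r * (Real.sin α *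
        (Real.cos p.1 * Real.cos p.2) - Real.cos α * Real.sin p.1) : ℝ))) := fun p ↦ by
    refine (hAf p).hasDerivAt_fst.unique ?_
    have e1 : HasDerivAt (fun x ↦ r * (Real.sin α * (Real.sin x * Real.cos p.2) +
        Real.cos α * Real.cos x)) (r * (Real.sin α * (Real.cos p.1 * Real.cos p.2) -
          Real.cos α * Real.sin p.1)) p.1 := by
      refine (((((Real.hasDerivAt_sin p.1).mul_const _).const_mul _).fun_add
        ((Real.hasDerivAt_cos p.1).const_mul _)).const_mul r).congr_deriv ?_
      ring
    have e2 : HasDerivAt (fun x ↦ -(Real.sin x * Real.cos p.2)) (-(Real.cos p.1 * Real.cos p.2))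
        p.1 := ((Real.hasDerivAt_sin p.1).mul_const _).fun_neg
    exact e2.ofReal_comp.mul ((e1.ofReal_comp.const_mul Complex.I).cexp)
  have hB1 : ∀ p, fderiv ℝ B p (0, 1) = ((Real.cos p.1 * Real.cos p.2 : ℝ) : ℂ) * f p +
      ((Real.cos p.1 * Real.sin p.2 : ℝ) : ℂ) * (f p * (Complex.I * (r * (Real.sin α *
        (Real.sin p.1 * -Real.sin p.2)) : ℝ))) := fun p ↦ by
    refine (hBf p).hasDerivAt_snd.unique ?_
    have e1 : HasDerivAt (fun x ↦ r * (Real.sin α * (Real.sin p.1 * Real.cos x) +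
        Real.cos α * Real.cos p.1)) (r * (Real.sin α * (Real.sin p.1 * -Real.sin p.2))) p.2 :=
      ((((Real.hasDerivAt_cos p.2).const_mul _).const_mul _).add_const _).const_mul r
    have e2 : HasDerivAt (fun x ↦ Real.cos p.1 * Real.sin x) (Real.cos p.1 * Real.cos p.2)
        p.2 := (Real.hasDerivAt_sin p.2).const_mul _
    exact e2.ofReal_comp.mul ((e1.ofReal_comp.const_mul Complex.I).cexp)
  have hle : ((0, -Real.pi) : ℝ × ℝ) ≤ (Real.pi, Real.pi) :=
    ⟨Real.pi_pos.le, by linarith [Real.pi_pos]⟩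
  have hcont : Continuous fun p ↦ fderiv ℝ A p (1, 0) + fderiv ℝ B p (0, 1) :=
    ((hAd.continuous_fderiv (by norm_num)).clm_apply continuous_const).add
      ((hBd.continuous_fderiv (by norm_num)).clm_apply continuous_const)
  have key := integral_divergence_prod_Icc_of_hasFDerivAt_of_le A B (fderiv ℝ A) (fderiv ℝ B)
    (0, -Real.pi) (Real.pi, Real.pi) hle hAd.continuous.continuousOn hBd.continuous.continuousOn
    (fun p _ ↦ hAf p) (fun p _ ↦ hBf p)
    (hcont.continuousOn.integrableOn_compact isCompact_Icc)
  simp only [hA, hB, Real.sin_pi, Real.sin_neg, Real.sin_zero] at key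
  simp only [mul_zero, zero_mul, neg_zero, Complex.ofReal_zero, intervalIntegral.integral_zero,
    sub_self, add_zero] at key
  rw [← key]
  refine setIntegral_congr_fun measurableSet_Icc fun p _ ↦ ?_
  have := hA1 p
  have h2 := hB1 p
  simp only [hA, hB] at this h2
  simp only [this, h2]
  have hs : (Real.sin p.2 : ℂ) ^ 2 = 1 - (Real.cos p.2 : ℂ) ^ 2 := by
    rw [← Complex.ofReal_pow, Real.sin_sq]; push_cast; ring
  simp only [hf]
  push_cast at hs ⊢
  linear_combination (Complex.exp (Complex.I * (r * (Complex.sin α *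
    (Complex.sin p.1 * Complex.cos p.2) + Complex.cos α * Complex.cos p.1))) *
    Complex.I * r * Complex.sin α * Complex.sin p.1 * Complex.cos p.1) * hs

theorem norm_real_mul_exp_I (x y : ℝ) : ‖(x : ℂ) * Complex.exp (Complex.I * (y : ℝ))‖ = |x| := by
  rw [norm_mul, mul_comm Complex.I, Complex.norm_exp_ofReal_mul_I, mul_one, Complex.norm_real,
    Real.norm_eq_abs]

theorem integral_sphere_wave_rotate (r α : ℝ) :
    ∫ p in Set.Icc ((0, -Real.pi) : ℝ × ℝ) (Real.pi, Real.pi),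
      (Real.sin p.1 : ℂ) * Complex.exp (Complex.I *
        (r * (Real.sin α * (Real.sin p.1 * Real.cos p.2) + Real.cos α * Real.cos p.1) : ℝ)) =
    ∫ p in Set.Icc ((0, -Real.pi) : ℝ × ℝ) (Real.pi, Real.pi),
      (Real.sin p.1 : ℂ) * Complex.exp (Complex.I * (r * Real.cos p.1 : ℝ)) := by
  set S : ℝ → ℂ := fun α ↦ ∫ p in Set.Icc ((0, -Real.pi) : ℝ × ℝ) (Real.pi, Real.pi),
      (Real.sin p.1 : ℂ) * Complex.exp (Complex.I *
        (r * (Real.sin α * (Real.sin p.1 * Real.cos p.2) + Real.cos α * Real.cos p.1) : ℝ)) with hS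
  have hd : ∀ α, HasDerivAt S 0 α := fun α ↦ by
    refine (hasDerivAt_integral_of_dominated_loc_of_deriv_le (bound := fun _ ↦ |r| * 2)
      (F := fun α (p : ℝ × ℝ) ↦ (Real.sin p.1 : ℂ) * Complex.exp (Complex.I *
        (r * (Real.sin α * (Real.sin p.1 * Real.cos p.2) + Real.cos α * Real.cos p.1) : ℝ)))
      (F' := fun α p ↦ Complex.I * (r * (Real.cos α * (Real.sin p.1 * Real.cos p.2) -
          Real.sin α * Real.cos p.1) : ℝ) * (Real.sin p.1 * Complex.exp (Complex.I *
        (r * (Real.sin α * (Real.sin p.1 * Real.cos p.2) + Real.cos α * Real.cos p.1) : ℝ))))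
      (Filter.univ_mem : Set.univ ∈ nhds α) ?_ ?_ ?_ ?_ ?_ ?_).2.congr_deriv
      (integral_sphere_wave_deriv_eq_zero r α)
    · exact Filter.Eventually.of_forall fun _ ↦ Continuous.aestronglyMeasurable (by fun_prop)
    · exact (Continuous.continuousOn (by fun_prop)).integrableOn_compact isCompact_Icc
    · exact Continuous.aestronglyMeasurable (by fun_prop)
    · refine Filter.Eventually.of_forall fun p β _ ↦ ?_
      rw [norm_mul, norm_real_mul_exp_I, norm_mul, Complex.norm_I, one_mul, Complex.norm_real,
        Real.norm_eq_abs, abs_mul]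
      have h1 : |Real.cos β * (Real.sin p.1 * Real.cos p.2) - Real.sin β * Real.cos p.1| ≤ 2 := by
        refine (abs_sub _ _).trans ?_
        simp only [abs_mul]
        have a1 := Real.abs_cos_le_one β
        have a2 := Real.abs_sin_le_one p.1
        have a3 := Real.abs_cos_le_one p.2
        have a4 := Real.abs_sin_le_one β
        have a5 := Real.abs_cos_le_one p.1
        have b1 : |Real.sin p.1| * |Real.cos p.2| ≤ 1 := mul_le_one₀ a2 (abs_nonneg _) a3
        have b2 : |Real.cos β| * (|Real.sin p.1| * |Real.cos p.2|) ≤ 1 :=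
          mul_le_one₀ a1 (by positivity) b1
        have b3 : |Real.sin β| * |Real.cos p.1| ≤ 1 := mul_le_one₀ a4 (abs_nonneg _) a5
        linarith
      have h2 := Real.abs_sin_le_one p.1
      calc _ ≤ |r| * 2 * 1 := by gcongr
        _ = _ := mul_one _
    · refine integrableOn_const ?_
      exact isCompact_Icc.measure_lt_top.ne
    · exact Filter.Eventually.of_forall fun p β _ ↦ hasDerivAt_sphere_wave r β p
  have := is_const_of_deriv_eq_zero (fun α ↦ (hd α).differentiableAt) (fun α ↦ (hd α).deriv) α 0
  simpa [hS] using this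

theorem integral_sin_mul_exp_cos (r : ℝ) :
    ∫ θ in (0 : ℝ)..Real.pi, (Real.sin θ : ℂ) * Complex.exp (Complex.I * (r * Real.cos θ : ℝ)) =
      (2 * Real.sinc r : ℝ) := by
  rcases eq_or_ne r 0 with rfl | hr
  · simp only [zero_mul, Complex.ofReal_zero, mul_zero, Complex.exp_zero, mul_one, Real.sinc_zero]
    rw [intervalIntegral.integral_ofReal, integral_sin]
    norm_num
  · have hr' : (r : ℂ) ≠ 0 := by exact_mod_cast hr
    have hd : ∀ θ : ℝ, HasDerivAt
        (fun θ : ℝ ↦ Complex.I / r * Complex.exp (Complex.I * (r * Real.cos θ : ℝ)))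
        ((Real.sin θ : ℂ) * Complex.exp (Complex.I * (r * Real.cos θ : ℝ))) θ := fun θ ↦ by
      have e1 := (Real.hasDerivAt_cos θ).const_mul r
      refine (((e1.ofReal_comp.const_mul Complex.I).cexp).const_mul (Complex.I / r)).congr_deriv ?_
      push_cast
      field_simp
      rw [Complex.I_sq]
      ring
    rw [intervalIntegral.integral_eq_sub_of_hasDerivAt (fun θ _ ↦ hd θ)
      (Continuous.intervalIntegrable (by fun_prop) _ _), Real.sinc_of_ne_zero hr]
    simp only [Real.cos_pi, Real.cos_zero, mul_one, mul_neg]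
    push_cast
    rw [Complex.sin]
    rw [show -(r : ℂ) * Complex.I = Complex.I * -r by ring,
      show (r : ℂ) * Complex.I = Complex.I * r by ring]
    field_simp

theorem integral_Icc_sphere_eq (f : ℝ → ℝ → ℂ) (hf : Continuous (Function.uncurry f)) :
    ∫ p in Set.Icc ((0, -Real.pi) : ℝ × ℝ) (Real.pi, Real.pi), f p.1 p.2 =
      ∫ θ in (0 : ℝ)..Real.pi, ∫ φ in (-Real.pi)..Real.pi, f θ φ := by
  have hπ := Real.pi_pos
  rw [intervalIntegral.integral_of_le hπ.le, ← integral_Icc_eq_integral_Ioc]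
  simp_rw [intervalIntegral.integral_of_le (show -Real.pi ≤ Real.pi by linarith),
    ← integral_Icc_eq_integral_Ioc]
  rw [← Set.Icc_prod_Icc, Measure.volume_eq_prod]
  refine setIntegral_prod _ ?_
  rw [Set.Icc_prod_Icc]
  exact hf.continuousOn.integrableOn_compact isCompact_Icc

theorem integral_sphere_wave_axis (r : ℝ) :
    ∫ p in Set.Icc ((0, -Real.pi) : ℝ × ℝ) (Real.pi, Real.pi),
      (Real.sin p.1 : ℂ) * Complex.exp (Complex.I * (r * Real.cos p.1 : ℝ)) =
      (4 * Real.pi * Real.sinc r : ℝ) := by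
  rw [integral_Icc_sphere_eq
    (fun θ _ ↦ (Real.sin θ : ℂ) * Complex.exp (Complex.I * (r * Real.cos θ : ℝ)))
    (by simp only [Function.uncurry_def]; fun_prop)]
  simp only [intervalIntegral.integral_const, intervalIntegral.integral_smul,
    integral_sin_mul_exp_cos]
  rw [Complex.real_smul]
  push_cast
  ring

/-- The Fourier transform of the surface measure of the unit sphere, in spherical coordinates. -/
theorem integral_sphere_wave (x y z : ℝ) :
    ∫ p in Set.Ioo 0 Real.pi ×ˢ Set.Ioo (-Real.pi) Real.pi,
      (Real.sin p.1 : ℂ) * Complex.exp (Complex.I * (x * (Real.sin p.1 * Real.cos p.2) +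
        y * (Real.sin p.1 * Real.sin p.2) + z * Real.cos p.1 : ℝ)) =
      (4 * Real.pi * Real.sinc (Real.sqrt (x ^ 2 + y ^ 2 + z ^ 2)) : ℝ) := by
  have hset : (Set.Ioo 0 Real.pi ×ˢ Set.Ioo (-Real.pi) Real.pi : Set (ℝ × ℝ)) =ᵐ[volume]
      Set.Icc ((0, -Real.pi) : ℝ × ℝ) (Real.pi, Real.pi) := by
    rw [← Set.Icc_prod_Icc]
    exact Measure.set_prod_ae_eq Ioo_ae_eq_Icc Ioo_ae_eq_Icc
  rw [setIntegral_congr_set hset]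
  -- Polar coordinates twice, (x, y) = b(cos φ₀, sin φ₀) and (z, b) = r(cos α, sin α). The angle φ₀
  -- disappears by periodicity in φ, and α by the rotation lemma.
  set b := ‖(⟨x, y⟩ : ℂ)‖
  set φ₀ := Complex.arg (⟨x, y⟩ : ℂ)
  have hx : x = b * Real.cos φ₀ := (Complex.norm_mul_cos_arg (⟨x, y⟩ : ℂ)).symm
  have hy : y = b * Real.sin φ₀ := (Complex.norm_mul_sin_arg (⟨x, y⟩ : ℂ)).symm
  set r := ‖(⟨z, b⟩ : ℂ)‖
  set α := Complex.arg (⟨z, b⟩ : ℂ)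
  have hz : z = r * Real.cos α := (Complex.norm_mul_cos_arg (⟨z, b⟩ : ℂ)).symm
  have hb : b = r * Real.sin α := (Complex.norm_mul_sin_arg (⟨z, b⟩ : ℂ)).symm
  have hr : Real.sqrt (x ^ 2 + y ^ 2 + z ^ 2) = r := by
    rw [Real.sqrt_eq_iff_eq_sq (by positivity) (norm_nonneg _)]
    linear_combination (x + b * Real.cos φ₀) * hx + (y + b * Real.sin φ₀) * hy +
      (z + r * Real.cos α) * hz + (b + r * Real.sin α) * hb +
      b ^ 2 * Real.sin_sq_add_cos_sq φ₀ + r ^ 2 * Real.sin_sq_add_cos_sq α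
  rw [hr, ← integral_sphere_wave_axis, ← integral_sphere_wave_rotate r α]
  rw [integral_Icc_sphere_eq (fun θ φ ↦ (Real.sin θ : ℂ) * Complex.exp (Complex.I *
      (x * (Real.sin θ * Real.cos φ) + y * (Real.sin θ * Real.sin φ) + z * Real.cos θ : ℝ)))
      (by simp only [Function.uncurry_def]; fun_prop),
    integral_Icc_sphere_eq (fun θ φ ↦ (Real.sin θ : ℂ) * Complex.exp (Complex.I *
      (r * (Real.sin α * (Real.sin θ * Real.cos φ) + Real.cos α * Real.cos θ) : ℝ)))
      (by simp only [Function.uncurry_def]; fun_prop)]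
  refine intervalIntegral.integral_congr fun θ _ ↦ ?_
  set g : ℝ → ℂ := fun φ ↦ (Real.sin θ : ℂ) * Complex.exp (Complex.I *
      (r * (Real.sin α * (Real.sin θ * Real.cos φ) + Real.cos α * Real.cos θ) : ℝ)) with hg
  have hper : Function.Periodic g (2 * Real.pi) := fun φ ↦ by simp only [hg, Real.cos_add_two_pi]
  have hxy : ∀ φ : ℝ, (Real.sin θ : ℂ) * Complex.exp (Complex.I *
      (x * (Real.sin θ * Real.cos φ) + y * (Real.sin θ * Real.sin φ) + z * Real.cos θ : ℝ)) =
      g (φ - φ₀) := fun φ ↦ by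
    simp only [hg]
    congr 4
    rw [Real.cos_sub]
    linear_combination (Real.sin θ * Real.cos φ) * hx + (Real.sin θ * Real.sin φ) * hy +
      Real.cos θ * hz + (Real.cos φ₀ * Real.cos φ + Real.sin φ₀ * Real.sin φ) * Real.sin θ * hb
  simp only [hxy]
  rw [intervalIntegral.integral_comp_sub_right g φ₀]
  have := hper.intervalIntegral_add_eq (-Real.pi - φ₀) (-Real.pi)
  rw [show -Real.pi - φ₀ + 2 * Real.pi = Real.pi - φ₀ by ring,
    show -Real.pi + 2 * Real.pi = Real.pi by ring] at this
  exact this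

/-! ### Prolate spheroidal coordinates -/

/-- The planar elliptic coordinate map with foci `(0, ±1)`. -/
noncomputable def ellipticMap (p : ℝ × ℝ) : ℝ × ℝ :=
  (Real.sqrt (p.1 ^ 2 - 1) * Real.sin p.2, p.1 * Real.cos p.2)

/-- The derivative of `ellipticMap`. -/
noncomputable def ellipticMapDeriv (p : ℝ × ℝ) : ℝ × ℝ →L[ℝ] ℝ × ℝ :=
  (Matrix.toLin (.finTwoProd ℝ) (.finTwoProd ℝ)
    !![p.1 / Real.sqrt (p.1 ^ 2 - 1) * Real.sin p.2, Real.sqrt (p.1 ^ 2 - 1) * Real.cos p.2;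
      Real.cos p.2, -(p.1 * Real.sin p.2)]).toContinuousLinearMap

theorem hasFDerivAt_ellipticMap {p : ℝ × ℝ} (hp : 1 < p.1) :
    HasFDerivAt ellipticMap (ellipticMapDeriv p) p := by
  unfold ellipticMapDeriv
  rw [Matrix.toLin_finTwoProd_toContinuousLinearMap]
  have h0 : p.1 ^ 2 - 1 ≠ 0 := by nlinarith
  have h1 : HasDerivAt (fun s : ℝ ↦ Real.sqrt (s ^ 2 - 1)) (p.1 / Real.sqrt (p.1 ^ 2 - 1)) p.1 := by
    refine (((hasDerivAt_pow 2 p.1).sub_const 1).sqrt h0).congr_deriv ?_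
    norm_num
    rw [mul_div_mul_left _ _ (by norm_num)]
  refine (HasFDerivAt.prodMk (𝕜 := ℝ)
    ((h1.comp_hasFDerivAt p hasFDerivAt_fst).mul
      ((Real.hasDerivAt_sin p.2).comp_hasFDerivAt p hasFDerivAt_snd))
    (hasFDerivAt_fst.mul
      ((Real.hasDerivAt_cos p.2).comp_hasFDerivAt p hasFDerivAt_snd))).congr_fderiv ?_
  ext <;> simp [mul_comm]

theorem det_ellipticMapDeriv {p : ℝ × ℝ} (hp : 1 < p.1) :
    (ellipticMapDeriv p).det = -((p.1 ^ 2 - Real.cos p.2 ^ 2) / Real.sqrt (p.1 ^ 2 - 1)) := by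
  have h0 : 0 < p.1 ^ 2 - 1 := by nlinarith
  have h1 := Real.sqrt_pos.2 h0
  have h2 := Real.sq_sqrt h0.le
  unfold ellipticMapDeriv
  simp only [LinearMap.det_toContinuousLinearMap, LinearMap.det_toLin, Matrix.det_fin_two_of]
  field_simp
  rw [h2]
  linear_combination (-p.1 ^ 2) * Real.sin_sq_add_cos_sq p.2

theorem sqrt_sq_add_sq_ellipticMap {p : ℝ × ℝ} (hp : 1 < p.1) (s : ℝ) (hs : s ^ 2 = 1) :
    Real.sqrt ((ellipticMap p).1 ^ 2 + ((ellipticMap p).2 + s) ^ 2) = p.1 + s * Real.cos p.2 := by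
  have h0 : 0 ≤ p.1 ^ 2 - 1 := by nlinarith
  have h1 : (s * Real.cos p.2) ^ 2 ≤ 1 := by
    rw [mul_pow, hs, one_mul]
    exact Real.cos_sq_le_one _
  have h2 := (abs_le.1 ((sq_le_one_iff_abs_le_one _).1 h1)).1
  rw [Real.sqrt_eq_iff_eq_sq (by positivity) (by linarith)]
  simp only [ellipticMap, mul_pow, Real.sq_sqrt h0]
  linear_combination (p.1 ^ 2 - 1) * Real.sin_sq_add_cos_sq p.2 + (1 - Real.cos p.2 ^ 2) * hs

/-- The distances to the foci are σ ± cos θ; they determine σ and cos θ, and cos is injective on [0,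
π]. -/
theorem injOn_ellipticMap : Set.InjOn ellipticMap (Set.Ioi 1 ×ˢ Set.Ioo 0 Real.pi) := by
  intro p hp q hq h
  have hp1 : 1 < p.1 := hp.1
  have hq1 : 1 < q.1 := hq.1
  have a1 := sqrt_sq_add_sq_ellipticMap hp1 1 (by norm_num)
  have a2 := sqrt_sq_add_sq_ellipticMap hp1 (-1) (by norm_num)
  rw [h, sqrt_sq_add_sq_ellipticMap hq1 _ (by norm_num)] at a1 a2
  have e1 : p.1 = q.1 := by linarith
  have e2 : Real.cos p.2 = Real.cos q.2 := by linarith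
  refine Prod.ext e1 (Real.injOn_cos ⟨hp.2.1.le, hp.2.2.le⟩ ⟨hq.2.1.le, hq.2.2.le⟩ e2)

theorem image_ellipticMap :
    ellipticMap '' (Set.Ioi 1 ×ˢ Set.Ioo 0 Real.pi) = Set.Ioi 0 ×ˢ Set.univ := by
  ext ⟨ρ, z⟩
  constructor
  · rintro ⟨p, hp, hpe⟩
    have hp1 : 1 < p.1 := hp.1
    rw [← hpe]
    refine ⟨mul_pos (Real.sqrt_pos.2 (by nlinarith)) (Real.sin_pos_of_mem_Ioo hp.2), trivial⟩
  · rintro ⟨hρ : 0 < ρ, -⟩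
    have p1 : 0 ≤ ρ ^ 2 + (z + 1) ^ 2 := by positivity
    have p2 : 0 ≤ ρ ^ 2 + (z - 1) ^ 2 := by positivity
    set a := Real.sqrt (ρ ^ 2 + (z + 1) ^ 2)
    set b := Real.sqrt (ρ ^ 2 + (z - 1) ^ 2)
    have ha : a ^ 2 = ρ ^ 2 + (z + 1) ^ 2 := Real.sq_sqrt p1
    have hb : b ^ 2 = ρ ^ 2 + (z - 1) ^ 2 := Real.sq_sqrt p2
    have ha1 : |z + 1| < a := Real.lt_sqrt_of_sq_lt (by rw [sq_abs]; nlinarith)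
    have hb1 : |z - 1| < b := Real.lt_sqrt_of_sq_lt (by rw [sq_abs]; nlinarith)
    have hσ : 1 < (a + b) / 2 := by
      have := le_abs_self (z + 1)
      have := neg_abs_le (z - 1)
      linarith
    -- The preimage is σ = (a + b)/2, cos θ = (a - b)/2; this identity both forces |cos θ| < 1 and
    -- recovers ρ.
    have hprod : (((a + b) / 2) ^ 2 - 1) * (1 - ((a - b) / 2) ^ 2) = ρ ^ 2 := by
      have e1 : ((a + b) / 2) ^ 2 + ((a - b) / 2) ^ 2 = ρ ^ 2 + z ^ 2 + 1 := by
        linear_combination (ha + hb) / 2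
      have e2 : ((a + b) / 2) * ((a - b) / 2) = z := by linear_combination (ha - hb) / 4
      linear_combination e1 - (((a + b) / 2) * ((a - b) / 2) + z) * e2
    have hσ2 : 0 < ((a + b) / 2) ^ 2 - 1 := by nlinarith
    have hc2 : 0 < 1 - ((a - b) / 2) ^ 2 := by
      by_contra h
      have : (((a + b) / 2) ^ 2 - 1) * (1 - ((a - b) / 2) ^ 2) ≤ 0 :=
        mul_nonpos_of_nonneg_of_nonpos hσ2.le (not_lt.1 h)
      nlinarith
    have hc : |(a - b) / 2| < 1 := by rw [← sq_lt_one_iff_abs_lt_one]; linarith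
    obtain ⟨hc3, hc4⟩ := abs_lt.1 hc
    refine ⟨((a + b) / 2, Real.arccos ((a - b) / 2)), ⟨hσ, ?_, ?_⟩, ?_⟩
    · exact Real.arccos_pos.2 hc4
    · exact (Real.arccos_le_pi _).lt_of_ne fun h ↦ by
        have := Real.arccos_eq_pi.1 h
        linarith
    · refine Prod.ext ?_ ?_
      · simp only [ellipticMap, Real.sin_arccos]
        rw [← Real.sqrt_mul hσ2.le, hprod, Real.sqrt_sq hρ.le]
      · simp only [ellipticMap, Real.cos_arccos hc3.le hc4.le]
        linear_combination (ha - hb) / 4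

theorem lintegral_ellipticMap (g : ℝ × ℝ → ℝ≥0∞) :
    ∫⁻ w in Set.Ioi 0 ×ˢ Set.univ, g w = ∫⁻ p in Set.Ioi 1 ×ˢ Set.Ioo 0 Real.pi,
      ENNReal.ofReal ((p.1 ^ 2 - Real.cos p.2 ^ 2) / Real.sqrt (p.1 ^ 2 - 1)) *
        g (ellipticMap p) := by
  have hm : MeasurableSet (Set.Ioi 1 ×ˢ Set.Ioo 0 Real.pi : Set (ℝ × ℝ)) :=
    measurableSet_Ioi.prod measurableSet_Ioo
  rw [← image_ellipticMap, lintegral_image_eq_lintegral_abs_det_fderiv_mul volume hm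
    (fun p hp ↦ (hasFDerivAt_ellipticMap hp.1).hasFDerivWithinAt) injOn_ellipticMap]
  refine setLIntegral_congr_fun hm fun p hp ↦ ?_
  have hp1 : 1 < p.1 := hp.1
  simp only [det_ellipticMapDeriv hp1, abs_neg]
  rw [abs_of_nonneg]
  refine div_nonneg ?_ (Real.sqrt_nonneg _)
  nlinarith [Real.cos_sq_le_one p.2]

/-- Prolate spheroidal coordinates with foci `(0, 0, ±1)`. -/
noncomputable def spheroidal (p : ℝ × ℝ × ℝ) : R3 :=
  !₂[Real.sqrt (p.1 ^ 2 - 1) * (Real.sin p.2.1 * Real.cos p.2.2),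
    Real.sqrt (p.1 ^ 2 - 1) * (Real.sin p.2.1 * Real.sin p.2.2), p.1 * Real.cos p.2.1]

theorem measurePreserving_cylinder :
    MeasurePreserving (fun q : ℝ × ℝ × ℝ ↦ (!₂[q.2.1, q.2.2, q.1] : R3)) := by
  have h1 := PiLp.volume_preserving_toLp (Fin 3)
  have h2 := (volume_preserving_piFinSuccAbove (fun _ : Fin 3 ↦ ℝ) 2).symm
  have h3 := (MeasurePreserving.id (volume : Measure ℝ)).prod
    (volume_preserving_finTwoArrow ℝ).symm
  rw [← Measure.volume_eq_prod, ← Measure.volume_eq_prod] at h3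
  convert h1.comp (h2.comp h3) using 1
  ext q i
  fin_cases i <;> rfl

theorem lintegral_spheroidal {f : R3 → ℝ≥0∞} (hf : Measurable f) :
    ∫⁻ ξ, f ξ = ∫⁻ p in Set.Ioi 1 ×ˢ (Set.Ioo 0 Real.pi ×ˢ Set.Ioo (-Real.pi) Real.pi),
      ENNReal.ofReal ((p.1 ^ 2 - Real.cos p.2.1 ^ 2) * Real.sin p.2.1) * f (spheroidal p) := by
  have hcyl : Measurable fun q : ℝ × ℝ × ℝ ↦ f (!₂[q.2.1, q.2.2, q.1] : R3) :=
    hf.comp measurePreserving_cylinder.measurable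
  have hH : Measurable fun w : (ℝ × ℝ) × ℝ ↦ ENNReal.ofReal w.1.1 *
      f (!₂[w.1.1 * Real.cos w.2, w.1.1 * Real.sin w.2, w.1.2] : R3) := by
    refine (by fun_prop : Measurable fun w : (ℝ × ℝ) × ℝ ↦ ENNReal.ofReal w.1.1).mul ?_
    exact hcyl.comp (by fun_prop : Measurable fun w : (ℝ × ℝ) × ℝ ↦
      (w.1.2, w.1.1 * Real.cos w.2, w.1.1 * Real.sin w.2))
  have hsph : Measurable spheroidal := measurePreserving_cylinder.measurable.comp
    (by fun_prop : Measurable fun p : ℝ × ℝ × ℝ ↦ (p.1 * Real.cos p.2.1,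
      Real.sqrt (p.1 ^ 2 - 1) * (Real.sin p.2.1 * Real.cos p.2.2),
      Real.sqrt (p.1 ^ 2 - 1) * (Real.sin p.2.1 * Real.sin p.2.2)))
  calc ∫⁻ ξ, f ξ = ∫⁻ q : ℝ × ℝ × ℝ, f (!₂[q.2.1, q.2.2, q.1] : R3) :=
        (measurePreserving_cylinder.lintegral_comp hf).symm
    _ = ∫⁻ z, ∫⁻ w : ℝ × ℝ, f (!₂[w.1, w.2, z] : R3) := by
        rw [Measure.volume_eq_prod, lintegral_prod _ hcyl.aemeasurable]
    _ = ∫⁻ z, ∫⁻ ρ in Set.Ioi (0 : ℝ), ∫⁻ φ in Set.Ioo (-Real.pi) Real.pi, ENNReal.ofReal ρ *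
          f (!₂[ρ * Real.cos φ, ρ * Real.sin φ, z] : R3) := by
        refine lintegral_congr fun z ↦ ?_
        rw [← lintegral_comp_polarCoord_symm, polarCoord_target, Measure.volume_eq_prod,
          setLIntegral_prod]
        · rfl
        · refine Measurable.aemeasurable ?_
          exact hH.comp (by fun_prop : Measurable fun p : ℝ × ℝ ↦ ((p.1, z), p.2))
    _ = ∫⁻ w in (Set.Ioi 0 ×ˢ Set.univ : Set (ℝ × ℝ)), ∫⁻ φ in Set.Ioo (-Real.pi) Real.pi,
          ENNReal.ofReal w.1 * f (!₂[w.1 * Real.cos φ, w.1 * Real.sin φ, w.2] : R3) := by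
        rw [Measure.volume_eq_prod, setLIntegral_prod_symm]
        · simp
        · exact (Measurable.lintegral_prod_right' hH).aemeasurable
    _ = ∫⁻ w in Set.Ioi 1 ×ˢ Set.Ioo 0 Real.pi, ∫⁻ φ in Set.Ioo (-Real.pi) Real.pi,
          ENNReal.ofReal ((w.1 ^ 2 - Real.cos w.2 ^ 2) * Real.sin w.2) *
            f (spheroidal (w.1, w.2, φ)) := by
        rw [lintegral_ellipticMap]
        refine setLIntegral_congr_fun (measurableSet_Ioi.prod measurableSet_Ioo) fun p hp ↦ ?_
        have hp1 : 1 < p.1 := hp.1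
        have hs := Real.sqrt_pos.2 (show 0 < p.1 ^ 2 - 1 by nlinarith)
        rw [← lintegral_const_mul']
        swap
        · exact ENNReal.ofReal_ne_top
        refine lintegral_congr fun φ ↦ ?_
        -- The polar factor ρ = √(σ² - 1) sin θ cancels the square root in the elliptic Jacobian.
        rw [← mul_assoc, ← ENNReal.ofReal_mul]
        · simp only [ellipticMap, spheroidal, mul_assoc]
          congr 2
          field_simp
        · refine div_nonneg ?_ (Real.sqrt_nonneg _)
          nlinarith [Real.cos_sq_le_one p.2]
    _ = _ := by
        have hM : Measurable fun p : ℝ × ℝ × ℝ ↦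
            ENNReal.ofReal ((p.1 ^ 2 - Real.cos p.2.1 ^ 2) * Real.sin p.2.1) *
              f (spheroidal p) :=
          (by fun_prop : Measurable fun p : ℝ × ℝ × ℝ ↦
            ENNReal.ofReal ((p.1 ^ 2 - Real.cos p.2.1 ^ 2) * Real.sin p.2.1)).mul (hf.comp hsph)
        have hM' := hM.comp (by fun_prop : Measurable fun w : (ℝ × ℝ) × ℝ ↦ (w.1.1, w.1.2, w.2))
        rw [Measure.volume_eq_prod, setLIntegral_prod]
        swap
        · exact (Measurable.lintegral_prod_right' hM').aemeasurable
        rw [Measure.volume_eq_prod (α := ℝ) (β := ℝ × ℝ), setLIntegral_prod _ hM.aemeasurable]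
        refine lintegral_congr fun σ ↦ ?_
        rw [Measure.volume_eq_prod (α := ℝ) (β := ℝ), setLIntegral_prod]
        exact (hM.comp (by fun_prop : Measurable fun w : ℝ × ℝ ↦ (σ, w))).aemeasurable

/-- The parameter domain of the spheroidal coordinates. -/
def spheroidalDomain : Set (ℝ × ℝ × ℝ) :=
  Set.Ioi 1 ×ˢ (Set.Ioo 0 Real.pi ×ˢ Set.Ioo (-Real.pi) Real.pi)

theorem measurableSet_spheroidalDomain : MeasurableSet spheroidalDomain :=
  measurableSet_Ioi.prod (measurableSet_Ioo.prod measurableSet_Ioo)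

theorem continuous_spheroidal : Continuous spheroidal := by
  unfold spheroidal
  refine (PiLp.continuous_toLp 2 _).comp (continuous_pi fun i ↦ ?_)
  fin_cases i <;> simp <;> fun_prop

/-- Phrasing the change of variables as a pushforward transfers it from Lebesgue integrals to
Bochner integrals without integrability conditions. -/
theorem volume_eq_map_spheroidal :
    (volume : Measure R3) = ((volume.restrict spheroidalDomain).withDensity fun p ↦
      ENNReal.ofReal ((p.1 ^ 2 - Real.cos p.2.1 ^ 2) * Real.sin p.2.1)).map spheroidal := by
  refine Measure.ext_of_lintegral _ fun f hf ↦ ?_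
  rw [lintegral_map hf continuous_spheroidal.measurable, lintegral_spheroidal hf]
  exact (lintegral_withDensity_eq_lintegral_mul _ (by fun_prop)
    (hf.comp continuous_spheroidal.measurable)).symm

theorem integral_spheroidal {F : R3 → ℂ} (hF : Continuous F) :
    ∫ ξ, F ξ = ∫ p in spheroidalDomain,
      ((p.1 ^ 2 - Real.cos p.2.1 ^ 2) * Real.sin p.2.1) • F (spheroidal p) := by
  rw [volume_eq_map_spheroidal, integral_map continuous_spheroidal.aemeasurable
    hF.aestronglyMeasurable, integral_withDensity_eq_integral_toReal_smul (by fun_prop)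
    (Filter.Eventually.of_forall fun _ ↦ ENNReal.ofReal_lt_top)]
  refine setIntegral_congr_fun measurableSet_spheroidalDomain fun p hp ↦ ?_
  have hp1 : 1 < p.1 := hp.1
  have hs := Real.sin_pos_of_mem_Ioo hp.2.1
  rw [ENNReal.toReal_ofReal]
  refine mul_nonneg ?_ hs.le
  nlinarith [Real.cos_sq_le_one p.2.1]

/-! ### The norm and the eigenfrequencies in spheroidal coordinates -/

theorem norm_sq_R3 (ξ : R3) : ‖ξ‖ ^ 2 = ξ 0 ^ 2 + ξ 1 ^ 2 + ξ 2 ^ 2 := by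
  rw [EuclideanSpace.norm_sq_eq, Fin.sum_univ_three]
  simp only [Real.norm_eq_abs, sq_abs]

theorem inner_R3 (x ξ : R3) : inner ℝ x ξ = x 0 * ξ 0 + x 1 * ξ 1 + x 2 * ξ 2 := by
  rw [PiLp.inner_apply, Fin.sum_univ_three]
  simp [mul_comm]

theorem norm_sq_spheroidal {p : ℝ × ℝ × ℝ} (hp : 1 ≤ p.1) :
    ‖spheroidal p‖ ^ 2 = p.1 ^ 2 + Real.cos p.2.1 ^ 2 - 1 := by
  have h0 : 0 ≤ p.1 ^ 2 - 1 := by nlinarith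
  rw [norm_sq_R3]
  simp only [spheroidal, PiLp.toLp_apply, Matrix.cons_val, mul_pow, Real.sq_sqrt h0]
  linear_combination (p.1 ^ 2 - 1) * Real.sin p.2.1 ^ 2 * Real.sin_sq_add_cos_sq p.2.2 +
    (p.1 ^ 2 - 1) * Real.sin_sq_add_cos_sq p.2.1

theorem eta_spheroidal (s : ℤˣ) {p : ℝ × ℝ × ℝ} (hp : 1 ≤ p.1) :
    eta s (spheroidal p) = p.1 + ((s : ℤ) : ℝ) * Real.cos p.2.1 := by
  have hs : ((s : ℤ) : ℝ) ^ 2 = 1 := by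
    rcases Int.units_eq_one_or s with rfl | rfl <;> simp
  have h1 : (((s : ℤ) : ℝ) * Real.cos p.2.1) ^ 2 ≤ 1 := by
    rw [mul_pow, hs, one_mul]
    exact Real.cos_sq_le_one _
  have h2 := (abs_le.1 ((sq_le_one_iff_abs_le_one _).1 h1)).1
  rw [eta, norm_sq_spheroidal hp]
  have e : p.1 ^ 2 + Real.cos p.2.1 ^ 2 - 1 + ((s : ℤ) : ℝ) * (2 * spheroidal p 2) + 1 =
      (p.1 + ((s : ℤ) : ℝ) * Real.cos p.2.1) ^ 2 := by
    simp only [spheroidal, PiLp.toLp_apply, Matrix.cons_val]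
    linear_combination (-Real.cos p.2.1 ^ 2) * hs
  rw [e, Real.sqrt_sq (by linarith)]

theorem lam_one_spheroidal {p : ℝ × ℝ × ℝ} (hp : 1 ≤ p.1) : lam 1 (spheroidal p) = p.1 := by
  rw [lam, eta_spheroidal _ hp, eta_spheroidal _ hp]
  push_cast
  ring

theorem lam_neg_one_spheroidal {p : ℝ × ℝ × ℝ} (hp : 1 ≤ p.1) :
    lam (-1) (spheroidal p) = Real.cos p.2.1 := by
  rw [lam, eta_spheroidal _ hp, eta_spheroidal _ hp]
  push_cast
  ring

/-! ### Bounds for the kernel in spheroidal coordinates -/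

/-- Integration by parts against the primitive of g; the weight is increasing, so the boundary
values and variation add up to 2Lⁿ. -/
theorem norm_integral_pow_smul_le {g : ℝ → ℂ} (hg : Continuous g) {M L : ℝ} (hL : 1 ≤ L)
    (hM : ∀ σ ∈ Set.Icc 1 L, ‖∫ s in (1 : ℝ)..σ, g s‖ ≤ M) (n : ℕ) :
    ‖∫ s in (1 : ℝ)..L, s ^ n • g s‖ ≤ 2 * M * L ^ n := by
  have hd : ∀ x ∈ Set.Icc 1 L, HasDerivAt (fun s : ℝ ↦ s ^ n) (n * x ^ (n - 1)) x :=
    fun x _ ↦ hasDerivAt_pow n x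
  have key := norm_integral_smul_le_of_antideriv (h := fun s ↦ s ^ n) (G := fun s ↦ s ^ n) hL
    (fun x _ ↦ (hg.integral_hasStrictDerivAt 1 x).hasDerivAt) hg.continuousOn hM hd
    (by fun_prop) hd (by fun_prop) (fun x hx ↦ by
      have : 0 ≤ x := by linarith [hx.1]
      rw [abs_of_nonneg (by positivity)])
  refine key.trans (le_of_eq ?_)
  rw [one_pow, abs_one, abs_of_nonneg (by positivity)]
  ring

/-- The part `σ ≤ L` of the parameter domain of the spheroidal coordinates. -/
def spheroidalBox (L : ℝ) : Set (ℝ × ℝ × ℝ) :=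
  Set.Ioc 1 L ×ˢ (Set.Ioo 0 Real.pi ×ˢ Set.Ioo (-Real.pi) Real.pi)

theorem measurableSet_spheroidalBox (L : ℝ) : MeasurableSet (spheroidalBox L) :=
  measurableSet_Ioc.prod (measurableSet_Ioo.prod measurableSet_Ioo)

theorem spheroidalBox_subset_domain (L : ℝ) : spheroidalBox L ⊆ spheroidalDomain :=
  Set.prod_mono Set.Ioc_subset_Ioi_self subset_rfl

theorem Continuous.integrableOn_spheroidalBox {f : ℝ × ℝ × ℝ → ℂ} (hf : Continuous f) (L : ℝ) :
    IntegrableOn f (spheroidalBox L) :=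
  (hf.continuousOn.integrableOn_compact
    (isCompact_Icc.prod (isCompact_Icc.prod isCompact_Icc))).mono_set
    (Set.prod_mono Set.Ioc_subset_Icc_self
      (Set.prod_mono Set.Ioo_subset_Icc_self Set.Ioo_subset_Icc_self))

theorem continuous_lam (s : ℤˣ) : Continuous (lam s) := by
  unfold lam eta
  fun_prop

/-- The amplitude `σ ^ n sin θ e^{itλ}` in spheroidal coordinates. -/
noncomputable def spheroidalAmplitude (s : ℤˣ) (t : ℝ) (n : ℕ) (p : ℝ × ℝ × ℝ) : ℂ :=
  ((p.1 ^ n * Real.sin p.2.1 : ℝ) : ℂ) * Complex.exp (Complex.I * (t * lam s (spheroidal p) : ℝ))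

theorem continuous_spheroidalAmplitude (s : ℤˣ) (t : ℝ) (n : ℕ) :
    Continuous (spheroidalAmplitude s t n) := by
  have := (continuous_lam s).comp continuous_spheroidal
  simp only [Function.comp_def] at this
  unfold spheroidalAmplitude
  fun_prop

theorem continuous_inner_spheroidal (x : R3) :
    Continuous fun p ↦ inner ℝ x (spheroidal p) :=
  continuous_const.inner continuous_spheroidal

theorem integral_spheroidalBox_eq {f : ℝ × ℝ × ℝ → ℂ} (hf : Continuous f) {L : ℝ} (hL : 1 ≤ L) :
    ∫ p in spheroidalBox L, f p = ∫ σ in (1 : ℝ)..L,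
      ∫ w in Set.Ioo 0 Real.pi ×ˢ Set.Ioo (-Real.pi) Real.pi, f (σ, w) := by
  rw [intervalIntegral.integral_of_le hL, spheroidalBox, Measure.volume_eq_prod]
  exact setIntegral_prod _ (hf.integrableOn_spheroidalBox L)

/-- A level set of σ is an ellipsoid, the linear image of the unit sphere with semi-axes √(σ² - 1),
√(σ² - 1), σ; the factor e^{itσ} is constant on it. -/
theorem integral_angles_one (x : R3) (t : ℝ) (n : ℕ) {σ : ℝ} (hσ : 1 ≤ σ) :
    ∫ w in Set.Ioo 0 Real.pi ×ˢ Set.Ioo (-Real.pi) Real.pi, spheroidalAmplitude 1 t n (σ, w) *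
        Complex.exp (Complex.I * (inner ℝ x (spheroidal (σ, w)) : ℝ)) =
      σ ^ n • ((4 * Real.pi) • (Real.sinc (Real.sqrt (‖x‖ ^ 2 * σ ^ 2 -
        Real.sqrt (x 0 ^ 2 + x 1 ^ 2) ^ 2)) • Complex.exp (Complex.I * (t * σ : ℝ)))) := by
  have h0 : 0 ≤ σ ^ 2 - 1 := by nlinarith
  have key := integral_sphere_wave (Real.sqrt (σ ^ 2 - 1) * x 0) (Real.sqrt (σ ^ 2 - 1) * x 1)
    (σ * x 2)
  have e : (Real.sqrt (σ ^ 2 - 1) * x 0) ^ 2 + (Real.sqrt (σ ^ 2 - 1) * x 1) ^ 2 + (σ * x 2) ^ 2 =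
      ‖x‖ ^ 2 * σ ^ 2 - Real.sqrt (x 0 ^ 2 + x 1 ^ 2) ^ 2 := by
    rw [Real.sq_sqrt (by positivity), norm_sq_R3, mul_pow, mul_pow, Real.sq_sqrt h0]
    ring
  rw [e] at key
  have hc : ∀ w : ℝ × ℝ, spheroidalAmplitude 1 t n (σ, w) *
        Complex.exp (Complex.I * (inner ℝ x (spheroidal (σ, w)) : ℝ)) =
      ((σ : ℂ) ^ n * Complex.exp (Complex.I * (t * σ : ℝ))) * ((Real.sin w.1 : ℂ) *
        Complex.exp (Complex.I * (Real.sqrt (σ ^ 2 - 1) * x 0 * (Real.sin w.1 * Real.cos w.2) +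
        Real.sqrt (σ ^ 2 - 1) * x 1 * (Real.sin w.1 * Real.sin w.2) +
          σ * x 2 * Real.cos w.1 : ℝ))) := fun w ↦ by
    have ei : inner ℝ x (spheroidal (σ, w)) =
        Real.sqrt (σ ^ 2 - 1) * x 0 * (Real.sin w.1 * Real.cos w.2) +
        Real.sqrt (σ ^ 2 - 1) * x 1 * (Real.sin w.1 * Real.sin w.2) +
          σ * x 2 * Real.cos w.1 := by
      rw [inner_R3]
      simp only [spheroidal, PiLp.toLp_apply, Matrix.cons_val]
      ring
    rw [spheroidalAmplitude, lam_one_spheroidal (p := (σ, w)) hσ, ei]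
    push_cast
    ring
  simp_rw [hc]
  rw [integral_const_mul, key]
  simp only [Complex.real_smul]
  push_cast
  ring

/-- Here tλ^- = t cos θ is linear on the unit sphere, so it only shifts the third dual variable from
σx₃ to σx₃ + t. -/
theorem integral_angles_neg_one (x : R3) (t : ℝ) (n : ℕ) {σ : ℝ} (hσ : 1 ≤ σ) :
    ∫ w in Set.Ioo 0 Real.pi ×ˢ Set.Ioo (-Real.pi) Real.pi, spheroidalAmplitude (-1) t n (σ, w) *
        Complex.exp (Complex.I * (inner ℝ x (spheroidal (σ, w)) : ℝ)) =
      σ ^ n • ((4 * Real.pi * Real.sinc (Real.sqrt (Real.sqrt (x 0 ^ 2 + x 1 ^ 2) ^ 2 *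
        (σ ^ 2 - 1) + (σ * x 2 + t) ^ 2)) : ℝ) : ℂ) := by
  have h0 : 0 ≤ σ ^ 2 - 1 := by nlinarith
  have key := integral_sphere_wave (Real.sqrt (σ ^ 2 - 1) * x 0) (Real.sqrt (σ ^ 2 - 1) * x 1)
    (σ * x 2 + t)
  have e : (Real.sqrt (σ ^ 2 - 1) * x 0) ^ 2 + (Real.sqrt (σ ^ 2 - 1) * x 1) ^ 2 +
      (σ * x 2 + t) ^ 2 =
      Real.sqrt (x 0 ^ 2 + x 1 ^ 2) ^ 2 * (σ ^ 2 - 1) + (σ * x 2 + t) ^ 2 := by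
    rw [Real.sq_sqrt (by positivity), mul_pow, mul_pow, Real.sq_sqrt h0]
    ring
  rw [e] at key
  have hc : ∀ w : ℝ × ℝ, spheroidalAmplitude (-1) t n (σ, w) *
        Complex.exp (Complex.I * (inner ℝ x (spheroidal (σ, w)) : ℝ)) =
      (σ : ℂ) ^ n * ((Real.sin w.1 : ℂ) *
        Complex.exp (Complex.I * (Real.sqrt (σ ^ 2 - 1) * x 0 * (Real.sin w.1 * Real.cos w.2) +
        Real.sqrt (σ ^ 2 - 1) * x 1 * (Real.sin w.1 * Real.sin w.2) +
          (σ * x 2 + t) * Real.cos w.1 : ℝ))) := fun w ↦ by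
    have ei : Real.sqrt (σ ^ 2 - 1) * x 0 * (Real.sin w.1 * Real.cos w.2) +
        Real.sqrt (σ ^ 2 - 1) * x 1 * (Real.sin w.1 * Real.sin w.2) +
          (σ * x 2 + t) * Real.cos w.1 = t * Real.cos w.1 + inner ℝ x (spheroidal (σ, w)) := by
      rw [inner_R3]
      simp only [spheroidal, PiLp.toLp_apply, Matrix.cons_val]
      ring
    rw [spheroidalAmplitude, lam_neg_one_spheroidal (p := (σ, w)) hσ, ei, Complex.ofReal_add,
      mul_add, Complex.exp_add]
    push_cast
    ring
  simp_rw [hc]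
  rw [integral_const_mul, key, Complex.real_smul, Complex.ofReal_pow]

theorem norm_integral_spheroidalBox_le (s : ℤˣ) {t : ℝ} (ht : t ≠ 0) (n : ℕ) {L : ℝ} (hL : 1 ≤ L)
    (x : R3) :
    ‖∫ p in spheroidalBox L, spheroidalAmplitude s t n p *
      Complex.exp (Complex.I * (inner ℝ x (spheroidal p) : ℝ))‖ ≤
      2 * (4 * Real.pi * (24 * L / |t|)) * L ^ n := by
  have hx := continuous_inner_spheroidal x
  have hm := continuous_spheroidalAmplitude s t n
  rw [integral_spheroidalBox_eq (by fun_prop) hL]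
  have hπ := Real.pi_pos
  have hb : Real.sqrt (x 0 ^ 2 + x 1 ^ 2) ≤ ‖x‖ := by
    rw [Real.sqrt_le_left (norm_nonneg _), norm_sq_R3]
    nlinarith [sq_nonneg (x 2)]
  rcases Int.units_eq_one_or s with rfl | rfl
  · rw [intervalIntegral.integral_congr (g := fun σ ↦ σ ^ n • ((4 * Real.pi) •
      (Real.sinc (Real.sqrt (‖x‖ ^ 2 * σ ^ 2 - Real.sqrt (x 0 ^ 2 + x 1 ^ 2) ^ 2)) •
        Complex.exp (Complex.I * (t * σ : ℝ)))))
      (fun σ hσ ↦ integral_angles_one x t n (by rw [Set.uIcc_of_le hL] at hσ; exact hσ.1))]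
    refine norm_integral_pow_smul_le ?_ hL (fun σ hσ ↦ ?_) n
    · have := continuous_sinc_sqrt
        (Q := fun σ ↦ ‖x‖ ^ 2 * σ ^ 2 - Real.sqrt (x 0 ^ 2 + x 1 ^ 2) ^ 2) (by fun_prop)
      fun_prop
    · rw [intervalIntegral.integral_smul, norm_smul, Real.norm_of_nonneg (by positivity)]
      refine mul_le_mul_of_nonneg_left ?_ (by positivity)
      exact norm_integral_sinc_smul_exp_le (Real.sqrt_nonneg _) hb ht hσ.1 hσ.2
  · rw [intervalIntegral.integral_congr (g := fun σ ↦ σ ^ n •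
      ((4 * Real.pi * Real.sinc (Real.sqrt (Real.sqrt (x 0 ^ 2 + x 1 ^ 2) ^ 2 *
        (σ ^ 2 - 1) + (σ * x 2 + t) ^ 2)) : ℝ) : ℂ))
      (fun σ hσ ↦ integral_angles_neg_one x t n (by rw [Set.uIcc_of_le hL] at hσ; exact hσ.1))]
    refine norm_integral_pow_smul_le ?_ hL (fun σ hσ ↦ ?_) n
    · exact Complex.continuous_ofReal.comp
        (continuous_const.mul (continuous_sinc_sqrt (by fun_prop)))
    · rw [intervalIntegral.integral_ofReal, Complex.norm_real, Real.norm_eq_abs,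
        intervalIntegral.integral_const_mul, abs_mul, abs_of_pos (by positivity)]
      refine mul_le_mul_of_nonneg_left ?_ (by positivity)
      refine (abs_integral_sinc_sqrt_affine_le ht hσ.1 hσ.2).trans ?_
      have : 0 < |t| := abs_pos.2 ht
      gcongr
      norm_num

/-- Multiplication by a dilated Schwartz function does not increase sup bounds for oscillatory
integrals by more than the `L¹` norm of its Fourier transform. -/
theorem norm_integral_mul_schwartz_le {α : Type*} [MeasurableSpace α] {μ : Measure α}
    [SFinite μ] {m : α → ℂ} {e : α → R3} (hm : Integrable m μ) (he : Measurable e) {B : ℝ}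
    (hB : ∀ x : R3, ‖∫ p, m p * Complex.exp (Complex.I * (inner ℝ x (e p) : ℝ)) ∂μ‖ ≤ B)
    (f : 𝓢(R3, ℂ)) (c : ℝ) (x : R3) :
    ‖∫ p, m p * Complex.exp (Complex.I * (inner ℝ x (e p) : ℝ)) * f (c • e p) ∂μ‖ ≤
      B * ∫ y, ‖𝓕 f y‖ := by
  have hinv : ∀ ξ : R3, f ξ =
      ∫ y, Complex.exp (Complex.I * (2 * Real.pi * inner ℝ y ξ : ℝ)) * 𝓕 f y := fun ξ ↦ by
    have h1 : 𝓕⁻ (𝓕 f) ξ = f ξ := by rw [fourierInv_fourier_eq]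
    rw [← h1, SchwartzMap.fourierInv_coe, Real.fourierInv_eq']
    refine integral_congr_ae (Filter.Eventually.of_forall fun y ↦ ?_)
    simp only [smul_eq_mul]
    rw [mul_comm Complex.I]
  have hfi : Integrable (fun y ↦ 𝓕 f y) := (𝓕 f).integrable
  -- Each plane wave in the inversion formula translates x, and the hypothesis is uniform in x.
  have hphase : ∀ (p : α) (y : R3), m p * Complex.exp (Complex.I * (inner ℝ x (e p) : ℝ)) *
      (Complex.exp (Complex.I * (2 * Real.pi * inner ℝ y (c • e p) : ℝ)) * 𝓕 f y) =
      𝓕 f y * (m p * Complex.exp (Complex.I *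
        (inner ℝ (x + (2 * Real.pi * c) • y) (e p) : ℝ))) := fun p y ↦ by
    rw [inner_add_left, real_inner_smul_left, real_inner_smul_right, Complex.ofReal_add, mul_add,
      Complex.exp_add]
    push_cast
    ring_nf
  have hswap : ∫ p, m p * Complex.exp (Complex.I * (inner ℝ x (e p) : ℝ)) * f (c • e p) ∂μ =
      ∫ y, ∫ p, 𝓕 f y * (m p * Complex.exp (Complex.I *
        (inner ℝ (x + (2 * Real.pi * c) • y) (e p) : ℝ))) ∂μ := by
    rw [← integral_integral_swap]
    · refine integral_congr_ae (Filter.Eventually.of_forall fun p ↦ ?_)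
      simp only
      rw [hinv, ← integral_const_mul]
      exact integral_congr_ae (Filter.Eventually.of_forall fun y ↦ hphase p y)
    · have hprod : Integrable (fun z : α × R3 ↦ m z.1 * 𝓕 f z.2) (μ.prod volume) :=
        hm.mul_prod hfi
      have hexp : Measurable fun z : α × R3 ↦ Complex.exp (Complex.I *
          (inner ℝ (x + (2 * Real.pi * c) • z.2) (e z.1) : ℝ)) := by
        have : Measurable fun z : α × R3 ↦ e z.1 := he.comp measurable_fst
        fun_prop
      refine (hprod.mul_bdd (c := 1) hexp.aestronglyMeasurable
        (Filter.Eventually.of_forall fun z ↦ ?_)).congr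
        (Filter.Eventually.of_forall fun z ↦ ?_)
      · rw [mul_comm Complex.I, Complex.norm_exp_ofReal_mul_I]
      · simp only [Function.uncurry_def]
        ring
  rw [hswap]
  simp_rw [integral_const_mul]
  refine (norm_integral_le_of_norm_le (hfi.norm.mul_const B)
    (Filter.Eventually.of_forall fun y ↦ ?_)).trans (le_of_eq ?_)
  · rw [norm_mul]
    exact mul_le_mul_of_nonneg_left (hB _) (norm_nonneg _)
  · rw [integral_mul_const, mul_comm]

/-- The oscillatory integral `∫ e^{i(x·ξ + tλ(ξ))} f(cξ) dξ`. -/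
noncomputable def dispersiveKernel (s : ℤˣ) (t c : ℝ) (f : R3 → ℂ) (x : R3) : ℂ :=
  ∫ ξ, Complex.exp (Complex.I * (inner ℝ x ξ : ℝ)) * Complex.exp (Complex.I * (t * lam s ξ : ℝ)) *
    f (c • ξ)

/-! ### Size and decay of the dispersive kernel -/

theorem norm_exp_I_mul_real (a : ℝ) : ‖Complex.exp (Complex.I * (a : ℝ))‖ = 1 := by
  rw [mul_comm, Complex.norm_exp_ofReal_mul_I]

theorem norm_dispersiveKernel_le_cube (s : ℤˣ) (t : ℝ) {R : ℝ} (hR : 0 < R) (f : 𝓢(R3, ℂ))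
    (x : R3) : ‖dispersiveKernel s t R⁻¹ f x‖ ≤ R ^ 3 * ∫ ξ, ‖f ξ‖ := by
  refine (norm_integral_le_integral_norm _).trans (le_of_eq ?_)
  simp only [norm_mul, norm_exp_I_mul_real, one_mul]
  rw [Measure.integral_comp_smul volume (fun ξ ↦ ‖f ξ‖), finrank_euclideanSpace, Fintype.card_fin,
    smul_eq_mul, inv_pow, inv_inv, abs_of_pos (by positivity)]

/-- The Jacobian factor is σ² - cos² θ = 2σ² - 1 - |ξ|², with |ξ|² = R² |ξ/R|² moved into the
cutoff. -/
theorem dispersiveKernel_eq_spheroidal (s : ℤˣ) (t : ℝ) {R L : ℝ} (hR : 0 < R) (hL : 1 ≤ L)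
    (hRL : 4 * R ^ 2 + 1 ≤ L ^ 2) (f : 𝓢(R3, ℂ)) (hf : ∀ ξ, 2 < ‖ξ‖ → f ξ = 0) (x : R3) :
    dispersiveKernel s t R⁻¹ f x =
      2 * (∫ p in spheroidalBox L, spheroidalAmplitude s t 2 p *
        Complex.exp (Complex.I * (inner ℝ x (spheroidal p) : ℝ)) * f (R⁻¹ • spheroidal p)) -
      (∫ p in spheroidalBox L, spheroidalAmplitude s t 0 p *
        Complex.exp (Complex.I * (inner ℝ x (spheroidal p) : ℝ)) * f (R⁻¹ • spheroidal p)) -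
      R ^ 2 * (∫ p in spheroidalBox L, spheroidalAmplitude s t 0 p *
        Complex.exp (Complex.I * (inner ℝ x (spheroidal p) : ℝ)) *
        SchwartzMap.smulLeftCLM ℂ (fun ξ : R3 ↦ ‖ξ‖ ^ 2) f (R⁻¹ • spheroidal p)) := by
  have hfc := f.continuous
  have hlam := continuous_lam s
  have hsph := continuous_spheroidal
  have hin := continuous_inner_spheroidal x
  have hm2 := continuous_spheroidalAmplitude s t 2
  have hm0 := continuous_spheroidalAmplitude s t 0
  have hgc := (SchwartzMap.smulLeftCLM ℂ (fun ξ : R3 ↦ ‖ξ‖ ^ 2) f).continuous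
  have hgrow : (fun ξ : R3 ↦ ‖ξ‖ ^ 2).HasTemperateGrowth := by fun_prop
  rw [dispersiveKernel, integral_spheroidal (by fun_prop),
    setIntegral_eq_of_subset_of_forall_sdiff_eq_zero measurableSet_spheroidalDomain
      (spheroidalBox_subset_domain L) (fun p hp ↦ ?_),
    ← integral_const_mul, ← integral_const_mul, ← integral_sub, ← integral_sub]
  · refine setIntegral_congr_fun (measurableSet_spheroidalBox L) fun p hp ↦ ?_
    have hp1 : 1 < p.1 := hp.1.1
    have hn := norm_sq_spheroidal (p := p) hp1.le
    rw [SchwartzMap.smulLeftCLM_apply_apply hgrow, norm_smul, mul_pow, Real.norm_eq_abs, sq_abs, hn]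
    simp only [spheroidalAmplitude, Complex.real_smul]
    have hR' : (R : ℂ) ≠ 0 := by exact_mod_cast hR.ne'
    push_cast
    field_simp
    ring
  · exact (Continuous.integrableOn_spheroidalBox (by fun_prop) L)
  · exact (Continuous.integrableOn_spheroidalBox (by fun_prop) L)
  · exact (Continuous.integrableOn_spheroidalBox (by fun_prop) L)
  · exact (Continuous.integrableOn_spheroidalBox (by fun_prop) L)
  -- Outside the box |ξ|² ≥ σ² - 1 > L² - 1 ≥ 4R², so the cutoff vanishes.
  · have hp1 : 1 < p.1 := hp.1.1
    have hpL : L < p.1 := by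
      by_contra h
      exact hp.2 ⟨⟨hp1, not_lt.1 h⟩, hp.1.2⟩
    have hn := norm_sq_spheroidal (p := p) hp1.le
    have h2 : 2 < ‖R⁻¹ • spheroidal p‖ := by
      rw [norm_smul, Real.norm_of_nonneg (by positivity), inv_mul_eq_div, lt_div_iff₀ hR]
      refine lt_of_pow_lt_pow_left₀ 2 (norm_nonneg _) ?_
      rw [hn]
      nlinarith [sq_nonneg (Real.cos p.2.1)]
    rw [hf _ h2]
    simp

theorem exists_norm_dispersiveKernel_mul_le (f : 𝓢(R3, ℂ)) (hf : ∀ ξ, 2 < ‖ξ‖ → f ξ = 0) :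
    ∃ C : ℝ, 0 ≤ C ∧ ∀ (s : ℤˣ) (t R : ℝ) (x : R3), 0 < R →
      ‖dispersiveKernel s t R⁻¹ f x‖ * |t| ≤ C * max R 1 ^ 3 := by
  set N := ∫ y, ‖𝓕 f y‖
  set N' := ∫ y, ‖𝓕 (SchwartzMap.smulLeftCLM ℂ (fun ξ : R3 ↦ ‖ξ‖ ^ 2) f) y‖
  have hN : 0 ≤ N := integral_nonneg fun _ ↦ norm_nonneg _
  have hN' : 0 ≤ N' := integral_nonneg fun _ ↦ norm_nonneg _
  have hπ := Real.pi_pos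
  -- 192π = 2 · 4π · 24 comes from the box estimate, 64 = 4³ from L = 4 max(R, 1), and 3N + N' from
  -- the weights 2, 1 and R².
  refine ⟨192 * Real.pi * 64 * (3 * N + N'), by positivity, fun s t R x hR ↦ ?_⟩
  rcases eq_or_ne t 0 with rfl | ht
  · simp only [abs_zero, mul_zero]
    positivity
  set M := max R 1
  have hM1 : 1 ≤ M := le_max_right _ _
  have hMR : R ≤ M := le_max_left _ _
  have hL : 1 ≤ 4 * M := by linarith
  have ht' : 0 < |t| := abs_pos.2 ht
  have hbound : ∀ (n : ℕ) (g : 𝓢(R3, ℂ)),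
      ‖∫ p in spheroidalBox (4 * M), spheroidalAmplitude s t n p *
        Complex.exp (Complex.I * (inner ℝ x (spheroidal p) : ℝ)) * g (R⁻¹ • spheroidal p)‖ ≤
      2 * (4 * Real.pi * (24 * (4 * M) / |t|)) * (4 * M) ^ n * ∫ y, ‖𝓕 g y‖ := fun n g ↦
    norm_integral_mul_schwartz_le
      ((continuous_spheroidalAmplitude s t n).integrableOn_spheroidalBox (4 * M))
      continuous_spheroidal.measurable (norm_integral_spheroidalBox_le s ht n hL) g R⁻¹ x
  rw [dispersiveKernel_eq_spheroidal s t hR hL (by nlinarith) f hf]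
  have b1 := hbound 2 f
  have b2 := hbound 0 f
  have b3 := hbound 0 (SchwartzMap.smulLeftCLM ℂ (fun ξ : R3 ↦ ‖ξ‖ ^ 2) f)
  set I₁ := ∫ p in spheroidalBox (4 * M), spheroidalAmplitude s t 2 p *
        Complex.exp (Complex.I * (inner ℝ x (spheroidal p) : ℝ)) * f (R⁻¹ • spheroidal p)
  set I₂ := ∫ p in spheroidalBox (4 * M), spheroidalAmplitude s t 0 p *
        Complex.exp (Complex.I * (inner ℝ x (spheroidal p) : ℝ)) * f (R⁻¹ • spheroidal p)
  set I₃ := ∫ p in spheroidalBox (4 * M), spheroidalAmplitude s t 0 p *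
        Complex.exp (Complex.I * (inner ℝ x (spheroidal p) : ℝ)) *
        SchwartzMap.smulLeftCLM ℂ (fun ξ : R3 ↦ ‖ξ‖ ^ 2) f (R⁻¹ • spheroidal p)
  have htri : ‖2 * I₁ - I₂ - R ^ 2 * I₃‖ ≤ 2 * ‖I₁‖ + ‖I₂‖ + R ^ 2 * ‖I₃‖ := by
    refine (norm_sub_le _ _).trans (add_le_add ((norm_sub_le _ _).trans ?_) ?_)
    · rw [norm_mul, Complex.norm_two]
    · rw [norm_mul, norm_pow, Complex.norm_real, Real.norm_of_nonneg hR.le]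
  have c1 : ‖I₁‖ * |t| ≤ 192 * Real.pi * (64 * M ^ 3) * N := by
    refine (mul_le_mul_of_nonneg_right b1 ht'.le).trans (le_of_eq ?_)
    field_simp
    ring
  have c2 : ‖I₂‖ * |t| ≤ 192 * Real.pi * (4 * M) * N := by
    refine (mul_le_mul_of_nonneg_right b2 ht'.le).trans (le_of_eq ?_)
    field_simp
    ring
  have c3 : ‖I₃‖ * |t| ≤ 192 * Real.pi * (4 * M) * N' := by
    refine (mul_le_mul_of_nonneg_right b3 ht'.le).trans (le_of_eq ?_)
    field_simp
    ring
  have m1 : 4 * M ≤ 64 * M ^ 3 := by nlinarith [mul_self_nonneg M]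
  have m2 : R ^ 2 * (4 * M) ≤ 64 * M ^ 3 := by
    have : R ^ 2 ≤ M ^ 2 := by gcongr
    nlinarith [mul_self_nonneg M]
  calc ‖2 * I₁ - I₂ - R ^ 2 * I₃‖ * |t| ≤ (2 * ‖I₁‖ + ‖I₂‖ + R ^ 2 * ‖I₃‖) * |t| := by gcongr
    _ = 2 * (‖I₁‖ * |t|) + ‖I₂‖ * |t| + R ^ 2 * (‖I₃‖ * |t|) := by ring
    _ ≤ 2 * (192 * Real.pi * (64 * M ^ 3) * N) + 192 * Real.pi * (4 * M) * N +
        R ^ 2 * (192 * Real.pi * (4 * M) * N') := by gcongr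
    _ = 192 * Real.pi * (2 * (64 * M ^ 3) * N + 4 * M * N + R ^ 2 * (4 * M) * N') := by ring
    _ ≤ 192 * Real.pi * (2 * (64 * M ^ 3) * N + 64 * M ^ 3 * N + 64 * M ^ 3 * N') := by gcongr
    _ = _ := by ring

theorem exists_norm_dispersiveKernel_le (f : 𝓢(R3, ℂ)) (hf : ∀ ξ, 2 < ‖ξ‖ → f ξ = 0) :
    ∃ C : ℝ, 0 < C ∧ ∀ (s : ℤˣ) (t R : ℝ) (x : R3), 0 < R →
      ‖dispersiveKernel s t R⁻¹ f x‖ ≤ C * R ^ 3 * (1 + min (R ^ 3) 1 * |t|)⁻¹ := by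
  obtain ⟨C, hC, hb⟩ := exists_norm_dispersiveKernel_mul_le f hf
  have hN : 0 ≤ ∫ ξ, ‖f ξ‖ := integral_nonneg fun _ ↦ norm_nonneg _
  refine ⟨(∫ ξ, ‖f ξ‖) + C + 1, by positivity, fun s t R x hR ↦ ?_⟩
  have hmin : 0 ≤ min (R ^ 3) 1 := by positivity
  rw [← div_eq_mul_inv, le_div_iff₀ (by positivity)]
  have h1 := norm_dispersiveKernel_le_cube s t hR f x
  have h2 := mul_le_mul_of_nonneg_left (hb s t R x hR) hmin
  -- This identity matches the decay bound to the trivial bound R³; adding the two gives the factor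
  -- 1 + min(R³, 1)|t|.
  have h3 : min (R ^ 3) 1 * (C * max R 1 ^ 3) = C * R ^ 3 := by
    rcases le_total R 1 with h | h
    · rw [max_eq_right h, min_eq_left (pow_le_one₀ hR.le h)]
      ring
    · rw [max_eq_left h, min_eq_right (one_le_pow₀ h)]
      ring
  have h4 : 0 < R ^ 3 := by positivity
  rw [h3] at h2
  linarith

/-! ### The dyadic blocks of the evolution -/

/-- The symbol `φ_j(D) e^{itλ(D)}`, without the datum, in the frequency variable of `𝓕`. -/
noncomputable def blockSymbol (s : ℤˣ) (t c : ℝ) (f : 𝓢(R3, ℂ)) (ξ : R3) : ℂ :=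
  f (c • ((2 * Real.pi) • ξ)) * Complex.exp (Complex.I * (t * lam s ((2 * Real.pi) • ξ) : ℝ))

theorem continuous_blockSymbol (s : ℤˣ) (t c : ℝ) (f : 𝓢(R3, ℂ)) :
    Continuous (blockSymbol s t c f) := by
  have hf := f.continuous
  have hl := continuous_lam s
  unfold blockSymbol
  fun_prop

theorem integrable_blockSymbol (s : ℤˣ) (t : ℝ) {c : ℝ} (hc : c ≠ 0) (f : 𝓢(R3, ℂ)) :
    Integrable (blockSymbol s t c f) := by
  have h2 : (2 * Real.pi) ≠ 0 := by positivity
  have hf : Integrable fun ξ : R3 ↦ f (c • ((2 * Real.pi) • ξ)) :=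
    (f.integrable.comp_smul hc).comp_smul h2
  refine hf.mono (continuous_blockSymbol s t c f).aestronglyMeasurable
    (Filter.Eventually.of_forall fun ξ ↦ ?_)
  rw [blockSymbol, norm_mul, norm_exp_I_mul_real, mul_one]

/-- Substituting 2πξ for ξ gives the dispersive kernel times (2π)⁻³, which is at most 1. -/
theorem norm_integral_exp_mul_blockSymbol_le {s : ℤˣ} {t c B : ℝ} {f : 𝓢(R3, ℂ)} (x : R3)
    (hB : ‖dispersiveKernel s t c f x‖ ≤ B) :
    ‖∫ ξ, Complex.exp (Complex.I * (2 * Real.pi * inner ℝ x ξ : ℝ)) * blockSymbol s t c f ξ‖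
      ≤ B := by
  have hπ := Real.pi_gt_three
  have h := Measure.integral_comp_smul (volume : Measure R3)
    (fun ξ ↦ Complex.exp (Complex.I * (inner ℝ x ξ : ℝ)) *
      Complex.exp (Complex.I * (t * lam s ξ : ℝ)) * f (c • ξ)) (2 * Real.pi)
  have e : ∀ ξ : R3, Complex.exp (Complex.I * (2 * Real.pi * inner ℝ x ξ : ℝ)) *
      blockSymbol s t c f ξ = Complex.exp (Complex.I * (inner ℝ x ((2 * Real.pi) • ξ) : ℝ)) *
      Complex.exp (Complex.I * (t * lam s ((2 * Real.pi) • ξ) : ℝ)) *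
        f (c • ((2 * Real.pi) • ξ)) := fun ξ ↦ by
    rw [blockSymbol, real_inner_smul_right]
    ring
  simp_rw [e]
  rw [h, norm_smul]
  refine le_trans (mul_le_of_le_one_left (norm_nonneg _) ?_) hB
  rw [finrank_euclideanSpace, Fintype.card_fin, Real.norm_eq_abs, abs_abs, abs_inv,
    abs_of_pos (by positivity)]
  exact inv_le_one_of_one_le₀ (one_le_pow₀ (by linarith))

/-- Young's inequality for L¹ and L^∞: by Fubini the left side is the convolution of ψ with the
inverse transform of m, which B bounds pointwise. -/
theorem norm_fourierInv_mul_fourier_le {m ψ : R3 → ℂ} (hm : Integrable m) (hψ : Integrable ψ)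
    {B : ℝ} (hB : ∀ x : R3,
      ‖∫ ξ, Complex.exp (Complex.I * (2 * Real.pi * inner ℝ x ξ : ℝ)) * m ξ‖ ≤ B) (x : R3) :
    ‖𝓕⁻ (fun ξ ↦ m ξ * 𝓕 ψ ξ) x‖ ≤ B * ∫ y, ‖ψ y‖ := by
  have hphase : ∀ ξ y : R3, Complex.exp (((2 * Real.pi * inner ℝ ξ x : ℝ) : ℂ) * Complex.I) *
      (m ξ * (Complex.exp (((-2 * Real.pi * inner ℝ y ξ : ℝ) : ℂ) * Complex.I) * ψ y)) =
      ψ y * (Complex.exp (Complex.I * (2 * Real.pi * inner ℝ (x - y) ξ : ℝ)) * m ξ) := fun ξ y ↦ by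
    rw [inner_sub_left, mul_sub, Complex.ofReal_sub, mul_sub, Complex.exp_sub,
      real_inner_comm x ξ, div_eq_mul_inv, ← Complex.exp_neg]
    push_cast
    ring_nf
  have hswap : 𝓕⁻ (fun ξ ↦ m ξ * 𝓕 ψ ξ) x = ∫ y, ∫ ξ, ψ y *
      (Complex.exp (Complex.I * (2 * Real.pi * inner ℝ (x - y) ξ : ℝ)) * m ξ) := by
    rw [Real.fourierInv_eq', ← integral_integral_swap]
    · refine integral_congr_ae (Filter.Eventually.of_forall fun ξ ↦ ?_)
      simp only [smul_eq_mul]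
      rw [Real.fourier_eq', ← integral_const_mul, ← integral_const_mul]
      exact integral_congr_ae (Filter.Eventually.of_forall fun y ↦ hphase ξ y)
    · have hprod : Integrable (fun z : R3 × R3 ↦ m z.1 * ψ z.2) (volume.prod volume) :=
        hm.mul_prod hψ
      have hexp : Continuous fun z : R3 × R3 ↦ Complex.exp (Complex.I *
          (2 * Real.pi * inner ℝ (x - z.2) z.1 : ℝ)) := by fun_prop
      refine (hprod.mul_bdd (c := 1) hexp.aestronglyMeasurable
        (Filter.Eventually.of_forall fun z ↦ ?_)).congr
        (Filter.Eventually.of_forall fun z ↦ ?_)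
      · rw [norm_exp_I_mul_real]
      · simp only [Function.uncurry_def]
        ring
  rw [hswap]
  simp_rw [integral_const_mul]
  refine (norm_integral_le_of_norm_le (hψ.norm.mul_const B)
    (Filter.Eventually.of_forall fun y ↦ ?_)).trans (le_of_eq ?_)
  · rw [norm_mul]
    exact mul_le_mul_of_nonneg_left (hB _) (norm_nonneg _)
  · rw [integral_mul_const, mul_comm]

theorem continuous_fourierInv_of_integrable {M : R3 → ℂ} (hM : Integrable M) :
    Continuous (𝓕⁻ M) :=
  VectorFourier.fourierIntegral_continuous Real.continuous_fourierChar
    (by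
      have : Continuous fun p : R3 × R3 ↦ -inner ℝ p.1 p.2 := continuous_inner.neg
      exact this) hM

theorem integral_mul_fourierInv_eq (u : 𝓢(R3, ℂ)) {M : R3 → ℂ} (hM : Integrable M) :
    ∫ x, u x * 𝓕⁻ M x = ∫ ξ, 𝓕⁻ u ξ * M ξ := by
  have hL : Continuous fun p : R3 × R3 ↦ (-innerₗ R3) p.1 p.2 := by
    have : Continuous fun p : R3 × R3 ↦ -inner ℝ p.1 p.2 := continuous_inner.neg
    exact this
  have := VectorFourier.integral_fourierIntegral_smul_eq_flip (L := -innerₗ R3) (μ := volume)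
    (ν := volume) Real.continuous_fourierChar hL u.integrable hM
  have hflip : (-innerₗ R3).flip = -innerₗ R3 := by
    ext x y
    simp [real_inner_comm]
  rw [hflip] at this
  rw [SchwartzMap.fourierInv_coe]
  exact this.symm

theorem mul_evolutionSymbol_eq (s : ℤˣ) (t c : ℝ) (f : 𝓢(R3, ℂ))
    (ψ : Lp ℂ 1 (volume : Measure R3)) (ξ : R3) :
    f (c • ((2 * Real.pi) • ξ)) * evolutionSymbol s t ψ ξ =
      blockSymbol s t c f ξ * 𝓕 (ψ : R3 → ℂ) ξ := by
  rw [evolutionSymbol, blockSymbol, ← mul_assoc]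
  congr 3
  push_cast
  ring

theorem integrable_blockSymbol_mul_fourier (s : ℤˣ) (t : ℝ) {c : ℝ} (hc : c ≠ 0) (f : 𝓢(R3, ℂ))
    {ψ : R3 → ℂ} (hψ : Integrable ψ) : Integrable fun ξ ↦ blockSymbol s t c f ξ * 𝓕 ψ ξ := by
  have hcont : Continuous (𝓕 ψ) := VectorFourier.fourierIntegral_continuous
    Real.continuous_fourierChar (by exact continuous_inner) hψ
  exact (integrable_blockSymbol s t hc f).mul_bdd (c := ∫ x, ‖ψ x‖) hcont.aestronglyMeasurable
    (Filter.Eventually.of_forall fun ξ ↦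
      VectorFourier.norm_fourierIntegral_le_integral_norm _ _ _ _ _)

/-- The tempered distribution `Δ_j e^{itλ^±(D)} ψ` is an `L^∞` function `g`, and its `L^∞` norm
obeys the dispersive bound. -/
theorem lemma3p3 (φ₀ : 𝓢(R3, ℝ)) (hφ₀ : IsLittlewoodPaley φ₀) :
    ∃ C : ℝ, 0 < C ∧
      ∀ (s : ℤˣ) (t : ℝ) (j : ℤ) (ψ : Lp ℂ 1 (volume : Measure R3)),
        ∃ g : Lp ℂ ∞ (volume : Measure R3),
          Lp.toTemperedDistribution g = dyadicBlock φ₀ j (evolution s t ψ) ∧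
          ‖g‖ ≤ C * (2 : ℝ) ^ (3 * j) * (1 + min ((2 : ℝ) ^ (3 * j)) 1 * |t|)⁻¹ * ‖ψ‖ := by
  set f : 𝓢(R3, ℂ) := φ₀.postcompCLM Complex.ofRealCLM
  have hfφ : ∀ ξ, f ξ = φ₀ ξ := fun ξ ↦ by simp [f]
  have hf : ∀ ξ, 2 < ‖ξ‖ → f ξ = 0 := fun ξ hξ ↦ by
    have h0 : φ₀ ξ = 0 := image_eq_zero_of_notMem_tsupport
      fun h ↦ absurd (hφ₀.support_subset h).2 (not_le.2 hξ)
    rw [hfφ, h0, Complex.ofReal_zero]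
  obtain ⟨C, hC, hK⟩ := exists_norm_dispersiveKernel_le f hf
  refine ⟨C, hC, fun s t j ψ ↦ ?_⟩
  have hψ : Integrable (ψ : R3 → ℂ) volume := L1.integrable_coeFn ψ
  set R : ℝ := (2 : ℝ) ^ j
  have hR : 0 < R := by positivity
  have hRinv : (2 : ℝ) ^ (-j) = R⁻¹ := zpow_neg 2 j
  have hR3 : (2 : ℝ) ^ (3 * j) = R ^ 3 := by
    rw [mul_comm, zpow_mul]
    norm_cast
  rw [hR3]
  set B := C * R ^ 3 * (1 + min (R ^ 3) 1 * |t|)⁻¹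
  have hB : 0 ≤ B := by positivity
  have hc : R⁻¹ ≠ 0 := by positivity
  set M : R3 → ℂ := fun ξ ↦ blockSymbol s t R⁻¹ f ξ * 𝓕 (ψ : R3 → ℂ) ξ with hMdef
  have hM : Integrable M := integrable_blockSymbol_mul_fourier s t hc f hψ
  have hbound : ∀ x, ‖𝓕⁻ M x‖ ≤ B * ‖ψ‖ := fun x ↦ by
    rw [L1.norm_eq_integral_norm]
    exact norm_fourierInv_mul_fourier_le (integrable_blockSymbol s t hc f) hψ
      (fun x ↦ norm_integral_exp_mul_blockSymbol_le x (hK s t R x hR)) x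
  have hmem : MemLp (𝓕⁻ M) ∞ (volume : Measure R3) :=
    memLp_top_of_bound (continuous_fourierInv_of_integrable hM).aestronglyMeasurable (B * ‖ψ‖)
      (Filter.Eventually.of_forall hbound)
  refine ⟨hmem.toLp _, ?_, ?_⟩
  -- Tested against u, both sides become the integral of 𝓕⁻u times the symbol times 𝓕ψ, by the
  -- multiplication formula.
  · ext u
    have hχ : (fun ξ : R3 ↦ ((φ₀ ((2 : ℝ) ^ (-j) • ((2 * Real.pi) • ξ)) : ℝ) : ℂ)) =
        fun ξ ↦ f (R⁻¹ • ((2 * Real.pi) • ξ)) := by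
      ext ξ
      rw [hfφ, hRinv]
    have hgrow : (fun ξ : R3 ↦ f (R⁻¹ • ((2 * Real.pi) • ξ))).HasTemperateGrowth := by
      have := f.hasTemperateGrowth
      fun_prop
    rw [dyadicBlock, hχ, TemperedDistribution.fourierMultiplierCLM_apply_apply, evolution,
      TemperedDistribution.fourierInv_apply, fourierInv_fourier_eq,
      Lp.toTemperedDistribution_apply, Lp.toTemperedDistribution_apply]
    have h1 : ∫ x, u x • (hmem.toLp (𝓕⁻ M)) x = ∫ x, u x * 𝓕⁻ M x := by
      refine integral_congr_ae ?_
      filter_upwards [hmem.coeFn_toLp] with x hx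
      rw [hx, smul_eq_mul]
    rw [h1, integral_mul_fourierInv_eq u hM]
    refine integral_congr_ae ?_
    filter_upwards [(evolutionSymbol_memLp s t ψ).coeFn_toLp] with ξ hξ
    rw [hξ, SchwartzMap.smulLeftCLM_apply_apply hgrow, hMdef]
    simp only [smul_eq_mul]
    rw [← mul_evolutionSymbol_eq]
    ring
  · rw [Lp.norm_toLp]
    refine ENNReal.toReal_le_of_le_ofReal (by positivity) ?_
    rw [eLpNorm_exponent_top]
    exact eLpNormEssSup_le_of_ae_bound (Filter.Eventually.of_forall hbound)
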